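/- **Setting.** Let $A=(a_{ij})\in\mathbb R^{n\times n}$ be the weighted adjacency matrix of a directed graph on $n$ agents: $a_{ij}\ge 0$, $a_{ii}=0$, and $a_{ij}>0$ means that there is a link from agent $j$ to agent $i$; put $N_i^{in}=\{j: a_{ij}>0\}$. Let $L=(l_{ij})=D-A$ be its Laplacian, where $D$ is the diagonal matrix of the in-degrees $\sum_j a_{ij}$, so that $l_{ii}=\sum_j a_{ij}$ and $l_{ij}=-a_{ij}$ for $j\neq i$. For $\delta>0$, $A$ contains a $\delta$-spanning tree if some agent has a directed path, along links of weight at least $\delta$, to every other agent. For $x\in\mathbb R^n$ let $d(x)=\max_i x_i-\min_i x_i$. A uniform quantizer with error bound $\delta_u$ is any function $q:\mathbb R\to\mathbb R$ with $|q(a)-a|\le\delta_u$ for all $a\in\mathbb R$. Each agent $i$ has its own triggering times $t^i_1<t^i_2<\cdots$: the first one is given, and, $t^i_k$ being known, $t^i_{k+1}$ is chosen arbitrarily in $$\Bigl(t^i_k+\frac{\delta_i}{l_{ii}},\;t^i_k+\frac{1-\delta_i}{l_{ii}}\Bigr).$$ (If $l_{ii}=0$, so that agent $i$ has no in-neighbours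 and zero input, its triggering times may be any increasing sequence tending to $\infty$.) For $t\ge t^i_1$ let $k_i(t)=\max\{k: t^i_k\le t\}$. Let $t_0$ be a time by which every agent has triggered at least once. A trajectory is a continuous function $x$ on $[t_0,\infty)$ with $$\dot x_i(t)=u_i(t)=\sum_{j\in N_i^{in}} l_{ij}\Bigl[q\bigl(x_i(t^i_{k_i(t)})\bigr)-q\bigl(x_j(t^j_{k_j(t)})\bigr)\Bigr],\qquad t\ge t_0,\ i=1,\dots,n,$$ where the derivative is the right derivative, and where the states sampled at triggering times before $t_0$ are arbitrary given data. **Theorem.** Let $n\in\mathbb N$, $\delta>0$ and $\delta_1,\dots,\delta_n\in(0,\tfrac12)$. There is a constant $C_2>0$, determined by $n,\delta,\delta_1,\dots,\delta_n$, such that the following holds. For every weighted directed graph on $n$ agents that contains a $\delta$-spanning tree there is a rate $c>0$ such that, for every $\delta_u$, every uniform quantizer $q$ with error bound $\delta_u$, all triggering times that obey the rule above, every such $t_0$, and every trajectory $x$ on $[t_0,\infty)$, the trajectory converges exponentially with rate $c$ to the consensus set $$\mathcal S=\{x\in\mathbb R^n: d(x)\le C_2\,\delta_u\},$$ that is, there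 is $K\ge 0$ with $\operatorname{dist}(x(t),\mathcal S)\le K e^{-c(t-t_0)}$ for all $t\ge t_0$. -/

import Mathlib

noncomputable section

namespace SelfTriggered

/-- `A` is a weighted adjacency matrix: nonnegative entries and no self-loops.
`A i j > 0` means that agent `j` sends information to agent `i`. -/
def IsAdjacency {n : ℕ} (A : Matrix (Fin n) (Fin n) ℝ) : Prop :=
  (∀ i j, 0 ≤ A i j) ∧ ∀ i, A i i = 0

/-- The weighted in-degree of agent `i`. -/
def inDegree {n : ℕ} (A : Matrix (Fin n) (Fin n) ℝ) (i : Fin n) : ℝ :=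
  ∑ j, A i j

/-- The weighted Laplacian `L = D - A`. -/
def laplacian {n : ℕ} (A : Matrix (Fin n) (Fin n) ℝ) : Matrix (Fin n) (Fin n) ℝ :=
  Matrix.diagonal (inDegree A) - A

/-- The graph of the nonnegative matrix `A` has a spanning tree: some agent `r` has a directed
path to every other agent. -/
def HasSpanningTree {n : ℕ} (A : Matrix (Fin n) (Fin n) ℝ) : Prop :=
  ∃ r : Fin n, ∀ j : Fin n, j ≠ r →
    Relation.TransGen (fun u v : Fin n => 0 < A v u) r j

/-- The `δ`-matrix of `A`: entries that are at least `δ` are replaced by `δ`, the others by `0`. -/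
def deltaMatrix {n : ℕ} (δ : ℝ) (A : Matrix (Fin n) (Fin n) ℝ) : Matrix (Fin n) (Fin n) ℝ :=
  Matrix.of fun i j => if δ ≤ A i j then δ else 0

/-- `A` contains a `δ`-spanning tree. -/
def HasDeltaSpanningTree {n : ℕ} (δ : ℝ) (A : Matrix (Fin n) (Fin n) ℝ) : Prop :=
  HasSpanningTree (deltaMatrix δ A)

/-- `d(x) = max_i x_i - min_i x_i`. -/
def spread {n : ℕ} (x : Fin n → ℝ) : ℝ :=
  (⨆ i, x i) - ⨅ i, x i

/-- `q` is a uniform quantizer with error bound `δu`. -/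
def IsUniformQuantizer (q : ℝ → ℝ) (δu : ℝ) : Prop :=
  ∀ a : ℝ, |q a - a| ≤ δu

/-- `s` is a triggering time sequence of an agent with in-degree `ℓ` and parameter `η`: an
increasing sequence of times without accumulation point in which, whatever the current triggering
time is, the next one is chosen in the interval prescribed by the self-triggered rule. If `ℓ > 0`,
the rule implies the first two clauses. If `ℓ = 0` (an agent without in-neighbours, whose input is
zero), the endpoints of the interval are not defined and the rule prescribes nothing. -/
structure IsTriggerSequence (ℓ η : ℝ) (s : ℕ → ℝ) : Prop where
  strictMono : StrictMono s
  unbounded : Filter.Tendsto s Filter.atTop Filter.atTop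
  rule : 0 < ℓ → ∀ k, s (k + 1) ∈ Set.Ioo (s k + η / ℓ) (s k + (1 - η) / ℓ)

/-- `k(t)`, the largest `k` with `s k ≤ t` (used only for `t ≥ s 0` and `s` unbounded). -/
def lastIndex (s : ℕ → ℝ) (t : ℝ) : ℕ :=
  sSup {k : ℕ | s k ≤ t}

/-- The state of agent `i` at its latest triggering time up to time `t`. -/
def sampled {n : ℕ} (s : Fin n → ℕ → ℝ) (x : ℝ → Fin n → ℝ) (t : ℝ) (i : Fin n) : ℝ :=
  x (s i (lastIndex (s i) t)) i

/-- The self-triggered input of agent `i` with quantized communication. -/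
def input {n : ℕ} (A : Matrix (Fin n) (Fin n) ℝ) (q : ℝ → ℝ) (s : Fin n → ℕ → ℝ)
    (x : ℝ → Fin n → ℝ) (t : ℝ) (i : Fin n) : ℝ :=
  ∑ j with 0 < A i j, laplacian A i j * (q (sampled s x t i) - q (sampled s x t j))

/-- `x` is a trajectory on `[t₀, ∞)` of `ẋ_i = u_i` with the self-triggered quantized input.
The input is piecewise constant and continuous from the right, so `ẋ_i` is the right derivative.
At `t₀` every agent has triggered at least once; values of `x` before `t₀` enter only as the
states sampled at triggering times before `t₀`, and are arbitrary. -/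
structure IsTrajectory {n : ℕ} (A : Matrix (Fin n) (Fin n) ℝ) (q : ℝ → ℝ)
    (s : Fin n → ℕ → ℝ) (t₀ : ℝ) (x : ℝ → Fin n → ℝ) : Prop where
  started : ∀ i, s i 0 ≤ t₀
  continuousOn : ContinuousOn x (Set.Ici t₀)
  deriv : ∀ t, t₀ ≤ t → ∀ i,
    HasDerivWithinAt (fun τ => x τ i) (input A q s x t i) (Set.Ici t) t

/-- On `[t₀, ∞)`, `x` converges to the set `S` exponentially with rate `c`. -/
def ConvergesExponentiallyTo {n : ℕ} (x : ℝ → Fin n → ℝ) (t₀ : ℝ) (S : Set (Fin n → ℝ))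
    (c : ℝ) : Prop :=
  ∃ K : ℝ, 0 ≤ K ∧ ∀ t, t₀ ≤ t → Metric.infDist (x t) S ≤ K * Real.exp (-c * (t - t₀))

end SelfTriggered

end

noncomputable section

namespace SelfTriggered

open Set Filter Topology

/-! ### Differential inequalities for right derivatives -/

/-! Sampling is harmless because of the triggering rule. If all relevant states lie below `Y`, then
agent `i` rises at rate at most its in-degree times the gap `Y - x_i` at its last sample, for a time
of at most `1 - η` over its in-degree, where `η` bounds all `δ_i` from below. So it keeps the
fraction `η` of that gap (`UpperWindow.eta_mul_le`), and states obey linear differential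
inequalities as in unsampled consensus, with the quantizer as a bounded perturbation. When degrees
and sample ages are bounded and every agent reaches a root along edges of weight at least `ε`, a low
root pulls every agent down and a high root pushes every agent up. The spread then contracts by a
fixed factor per period, up to a multiple of the perturbation (`SampledFlow.expBdd`).

This does not suffice: the constant must be the same for all graphs, while weights may differ by
arbitrary factors and slow agents may hold samples arbitrarily long. The target is `UniformBound`,
whose constant precedes the lag bound `h`, whereas the rate may depend on `h` and on the weights.
The proof is an induction on the number of agents. Time is scaled so that the largest weight is 1.
There are boundedly many weights, so lowering a threshold `ε` boundedly often produces a gap: every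
weight is at least `ε` or at most `φ`, with `φ` small compared with the constants belonging to `ε`
(`exists_bound_of_card_le`).

Along the strong edges every agent reaches a strongly connected class that no strong edge leaves;
let `S` contain one representative of each such class. The other agents are eliminated exactly:
adding suitable multiples `R i e` of their states to `x_i`, obtained from a Green function, cancels
their signals and leaves a smaller flow driven by the signals of `S` (`exists_elimination`,
`SampledFlow.reduce`). If the signals differ by at most `D`, weak edges perturb by a multiple of `φ
* D`. The averaged state stays close to the representative's signal: its own class contracts to it,
and the weights of agents outside the class are of order `φ`. The induction hypothesis bounds the
signals on `S`; lumping `S` into one root bounds the others. So a bound `D` improves to `C * (b + φ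
* D)` (`exists_improvement`). With `φ * C ≤ 1 / 2`, finitely many iterations starting from a
graph-dependent bound reach `3 * C * b` (`exists_separation`). -/

theorem le_add_mul_of_rightDeriv_le {f f' : ℝ → ℝ} {a b k : ℝ} (hf : ContinuousOn f (Icc a b))
    (hf' : ∀ t ∈ Ico a b, HasDerivWithinAt f (f' t) (Ici t) t) (hk : ∀ t ∈ Ico a b, f' t ≤ k)
    {t : ℝ} (ht : t ∈ Icc a b) : f t ≤ f a + k * (t - a) := by
  have hB : ∀ s : ℝ, HasDerivAt (fun s => f a + k * (s - a)) k s := fun s => by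
    simpa using (((hasDerivAt_id s).sub_const a).const_mul k).const_add (f a)
  exact image_le_of_deriv_right_le_deriv_boundary hf hf' (B := fun s => f a + k * (s - a))
    (B' := fun _ => k) (by simp) (fun s _ => (hB s).continuousAt.continuousWithinAt)
    (fun s _ => (hB s).hasDerivWithinAt) hk ht

theorem add_mul_le_of_le_rightDeriv {f f' : ℝ → ℝ} {a b k : ℝ} (hf : ContinuousOn f (Icc a b))
    (hf' : ∀ t ∈ Ico a b, HasDerivWithinAt f (f' t) (Ici t) t) (hk : ∀ t ∈ Ico a b, k ≤ f' t)
    {t : ℝ} (ht : t ∈ Icc a b) : f a + k * (t - a) ≤ f t := by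
  have := le_add_mul_of_rightDeriv_le (f := fun s => -f s) (f' := fun s => -f' s) (k := -k) hf.neg
    (fun s hs => (hf' s hs).neg) (fun s hs => neg_le_neg (hk s hs)) ht
  linarith

/-- Comparison with the linear equation `y' = p - lam * y`. -/
theorem linear_comparison {y y' : ℝ → ℝ} {a b p lam : ℝ} (hlam : 0 < lam)
    (hy : ContinuousOn y (Icc a b)) (hy' : ∀ t ∈ Ico a b, HasDerivWithinAt y (y' t) (Ici t) t)
    (hp : ∀ t ∈ Ico a b, p - lam * y t ≤ y' t) {t : ℝ} (ht : t ∈ Icc a b) :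
    p / lam + (y a - p / lam) * Real.exp (-lam * (t - a)) ≤ y t := by
  have hE : ∀ s : ℝ, HasDerivAt (fun s => Real.exp (lam * (s - a)))
      (Real.exp (lam * (s - a)) * lam) s := fun s => by
    simpa using ((((hasDerivAt_id s).sub_const a).const_mul lam).exp)
  -- Integrating factor: `(y - p / lam) * exp (lam * (s - a))` is nondecreasing.
  have key := add_mul_le_of_le_rightDeriv (k := 0)
    (f := fun s => (y s - p / lam) * Real.exp (lam * (s - a)))
    (f' := fun s => y' s * Real.exp (lam * (s - a)) +
      (y s - p / lam) * (Real.exp (lam * (s - a)) * lam))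
    ((hy.sub continuousOn_const).mul (fun s _ => (hE s).continuousAt.continuousWithinAt))
    (fun s hs => ((hy' s hs).sub_const _).mul (hE s).hasDerivWithinAt)
    (fun s hs => by
      have h1 := hp s hs
      have h2 : y' s * Real.exp (lam * (s - a)) +
          (y s - p / lam) * (Real.exp (lam * (s - a)) * lam)
          = (y' s - (p - lam * y s)) * Real.exp (lam * (s - a)) := by
        field_simp
        ring
      rw [h2]
      exact mul_nonneg (by linarith) (Real.exp_pos _).le) ht
  simp only [sub_self, mul_zero, Real.exp_zero, mul_one, zero_mul, add_zero] at key
  have h3 : Real.exp (lam * (t - a)) * Real.exp (-lam * (t - a)) = 1 := by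
    rw [← Real.exp_add]; simp
  have h4 := mul_le_mul_of_nonneg_right key (Real.exp_pos (-lam * (t - a))).le
  rw [mul_assoc, h3, mul_one] at h4
  linarith

/-- A finite family of functions stays below a barrier that moves faster than every member that
touches it. -/
theorem forall_le_barrier {ι : Type*} [Finite ι] {x u : ℝ → ι → ℝ} {B B' : ℝ → ℝ} {a b : ℝ}
    (hx : ∀ i, ContinuousOn (fun t => x t i) (Icc a b))
    (hu : ∀ t ∈ Ico a b, ∀ i, HasDerivWithinAt (fun s => x s i) (u t i) (Ici t) t)
    (hB : ∀ t, HasDerivAt B (B' t) t) (ha : ∀ i, x a i ≤ B a)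
    (touch : ∀ t ∈ Ico a b, (∀ s ∈ Icc a t, ∀ i, x s i ≤ B s) → ∀ i, x t i = B t → u t i < B' t) :
    ∀ t ∈ Icc a b, ∀ i, x t i ≤ B t := by
  have hBc : Continuous B := continuous_iff_continuousAt.2 fun t => (hB t).continuousAt
  have hclosed : IsClosed ({t | ∀ i, x t i ≤ B t} ∩ Icc a b) := by
    -- The extra index `none` contributes `Icc a b` itself, so that the intersection is right even
    -- for an empty family.
    have : {t | ∀ i, x t i ≤ B t} ∩ Icc a b
        = ⋂ i : Option ι, Icc a b ∩ {t | ∀ j, i = some j → x t j ≤ B t} := by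
      ext t
      simp only [mem_inter_iff, mem_ofPred_eq, mem_iInter]
      constructor
      · exact fun h i => ⟨h.2, fun j _ => h.1 j⟩
      · exact fun h => ⟨fun i => (h (some i)).2 i rfl, (h none).1⟩
    rw [this]
    refine isClosed_iInter fun i => ?_
    cases i with
    | none => simpa using isClosed_Icc
    | some i =>
      have := isClosed_Icc.isClosed_le (hx i) hBc.continuousOn
      convert this using 1
      ext t; simp
  -- Continuous induction on the interval: it remains to extend the bound slightly to the right of
  -- `t`. An agent strictly below the barrier stays there by continuity, a touching one by its
  -- smaller slope.
  refine hclosed.Icc_subset_of_forall_mem_nhdsGT_of_Icc_subset ha fun t ht hsub => ?_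
  change ∀ᶠ s in 𝓝[>] t, ∀ i, x s i ≤ B s
  rw [eventually_all]
  intro i
  have hle : x t i ≤ B t := hsub (right_mem_Icc.2 ht.1) i
  have hd : HasDerivWithinAt (fun s => x s i - B s) (u t i - B' t) (Ioi t) t :=
    ((hu t ht i).sub (hB t).hasDerivWithinAt).mono Ioi_subset_Ici_self
  rcases hle.lt_or_eq with hlt | heq
  · have : ∀ᶠ s in 𝓝[>] t, x s i - B s < 0 :=
      hd.continuousWithinAt.eventually_lt_const (by linarith)
    filter_upwards [this] with s hs using by linarith
  · have hneg := touch t ht (fun s hs j => hsub hs j) i heq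
    have := hd.limsup_slope_le' (self_notMem_Ioi) (r := 0) (by linarith)
    filter_upwards [this, self_mem_nhdsWithin] with s hs hts
    rw [slope_def_field, div_lt_iff₀ (sub_pos.2 hts)] at hs
    linarith

/-! ### Bounds up to an exponentially decaying term -/

/-- `f` is eventually below `b` up to a term that decays with rate `c`. -/
def ExpBdd (c b : ℝ) (f : ℝ → ℝ) : Prop :=
  ∃ K : ℝ, 0 ≤ K ∧ ∀ᶠ t in atTop, f t ≤ b + K * Real.exp (-c * t)

namespace ExpBdd

variable {c b b₁ b₂ : ℝ} {f g : ℝ → ℝ}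

theorem mono (hf : ExpBdd c b₁ f) (hb : b₁ ≤ b₂) (hgf : ∀ᶠ t in atTop, g t ≤ f t) :
    ExpBdd c b₂ g := by
  obtain ⟨K, hK, h⟩ := hf
  exact ⟨K, hK, by filter_upwards [h, hgf] with t h1 h2 using by linarith⟩

theorem mono_const (hf : ExpBdd c b₁ f) (hb : b₁ ≤ b₂) : ExpBdd c b₂ f :=
  hf.mono hb (Eventually.of_forall fun _ => le_rfl)

theorem of_le (h : ∀ᶠ t in atTop, f t ≤ b) : ExpBdd c b f :=
  ⟨0, le_rfl, by simpa using h⟩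

theorem add (hf : ExpBdd c b₁ f) (hg : ExpBdd c b₂ g) : ExpBdd c (b₁ + b₂) (fun t => f t + g t) := by
  obtain ⟨K, hK, h⟩ := hf
  obtain ⟨K', hK', h'⟩ := hg
  refine ⟨K + K', by positivity, ?_⟩
  filter_upwards [h, h'] with t h1 h2
  linarith [add_mul K K' (Real.exp (-c * t))]

theorem const_mul {k : ℝ} (hk : 0 ≤ k) (hf : ExpBdd c b f) : ExpBdd c (k * b) (fun t => k * f t) := by
  obtain ⟨K, hK, h⟩ := hf
  refine ⟨k * K, by positivity, ?_⟩
  filter_upwards [h] with t h1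
  have := mul_le_mul_of_nonneg_left h1 hk
  linarith [mul_add k b (K * Real.exp (-c * t)), mul_assoc k K (Real.exp (-c * t))]

theorem sum {ι : Type*} (s : Finset ι) {β : ι → ℝ} {F : ι → ℝ → ℝ}
    (h : ∀ i ∈ s, ExpBdd c (β i) (F i)) : ExpBdd c (∑ i ∈ s, β i) (fun t => ∑ i ∈ s, F i t) := by
  classical
  induction s using Finset.induction_on with
  | empty => simpa using of_le (c := c) (b := 0) (f := fun _ => 0) (by simp)
  | insert i s hi ih =>
    simp only [Finset.sum_insert hi]
    exact (h i (by simp)).add (ih fun j hj => h j (by simp [hj]))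

theorem sum_univ_const {ι : Type*} [Fintype ι] {F : ι → ℝ → ℝ}
    (h : ∀ i, ExpBdd c b (F i)) :
    ExpBdd c (Fintype.card ι * b) (fun t => ∑ i, F i t) := by
  simpa using sum Finset.univ (β := fun _ => b) (fun i _ => h i)

/-- A finite family has a common bound, on a common half-line and over all windows of length `h`. -/
theorem exists_forall_window {ι : Type*} [Finite ι] {F : ι → ℝ → ℝ} (hc : 0 ≤ c)
    (hF : ∀ i, ExpBdd c b (F i)) (h : ℝ) :
    ∃ K : ℝ, 0 ≤ K ∧ ∀ᶠ t in atTop, ∀ s, t - h ≤ s → ∀ i, F i s ≤ b + K * Real.exp (-c * t) := by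
  cases nonempty_fintype ι
  choose K hK hev using hF
  have hsum : 0 ≤ ∑ i, K i := Finset.sum_nonneg fun i _ => hK i
  refine ⟨(∑ i, K i) * Real.exp (c * h), by positivity, ?_⟩
  have hall : ∀ᶠ t in atTop, ∀ i, F i t ≤ b + K i * Real.exp (-c * t) := eventually_all.2 hev
  obtain ⟨T, hT⟩ := eventually_atTop.1 hall
  filter_upwards [eventually_ge_atTop (T + h)] with t ht s hs i
  have h1 := hT s (by linarith) i
  have h2 : K i ≤ ∑ j, K j := Finset.single_le_sum (fun j _ => hK j) (Finset.mem_univ i)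
  have h3 : Real.exp (-c * s) ≤ Real.exp (c * h) * Real.exp (-c * t) := by
    rw [← Real.exp_add]
    apply Real.exp_le_exp.2
    nlinarith
  calc F i s ≤ b + K i * Real.exp (-c * s) := h1
    _ ≤ b + (∑ j, K j) * (Real.exp (c * h) * Real.exp (-c * t)) := by gcongr
    _ = _ := by ring

/-- A bound survives a bounded change of the time argument. -/
theorem comp_lag {σ : ℝ → ℝ} {h : ℝ} (hc : 0 ≤ c) (hf : ExpBdd c b f)
    (hσ : ∀ᶠ t in atTop, t - h ≤ σ t) : ExpBdd c b (fun t => f (σ t)) := by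
  obtain ⟨K, hK, hev⟩ := exists_forall_window (ι := Unit) (F := fun _ => f) hc (fun _ => hf) h
  exact ⟨K, hK, by filter_upwards [hev, hσ] with t h1 h2 using h1 _ h2 ()⟩

end ExpBdd

/-! ### Flows driven by sampled signals -/

/-- `x_i' = ∑ j, a i j * (z_j - z_i) + g_i` on `[t₀, ∞)`, with a sampling time `θ t i` of agent `i`
that is constant from the sampling instant on, and whose age is at most `h` and at most
`(1 - η)` divided by the in-degree of `i`. -/
structure SampledFlow {ι : Type} [Fintype ι] (η h t₀ : ℝ) (a : ι → ι → ℝ)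
    (x z g θ : ℝ → ι → ℝ) : Prop where
  nonneg : ∀ i j, 0 ≤ a i j
  cont : ∀ i, ContinuousOn (fun t => x t i) (Ici t₀)
  deriv : ∀ t, t₀ ≤ t → ∀ i, HasDerivWithinAt (fun s => x s i)
    (∑ j, a i j * (z t j - z t i) + g t i) (Ici t) t
  le_time : ∀ t, t₀ ≤ t → ∀ i, θ t i ≤ t
  lag : ∀ t, t₀ ≤ t → ∀ i, t - h ≤ θ t i
  hold : ∀ t, t₀ ≤ t → ∀ i s, θ t i ≤ s → s ≤ t → θ s i = θ t i
  gain : ∀ t, t₀ ≤ t → ∀ i, (∑ j, a i j) * (t - θ t i) ≤ 1 - η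

section Flow

variable {ι : Type} [Fintype ι] {η h t₀ : ℝ} {a : ι → ι → ℝ} {x z g θ : ℝ → ι → ℝ}

/-- Reflection turns every upper estimate into a lower one. -/
theorem SampledFlow.neg (fl : SampledFlow η h t₀ a x z g θ) :
    SampledFlow η h t₀ a (fun t i => -x t i) (fun t i => -z t i) (fun t i => -g t i) θ where
  nonneg := fl.nonneg
  cont i := (fl.cont i).neg
  deriv t ht i := by
    have := (fl.deriv t ht i).neg
    refine this.congr_deriv ?_
    rw [neg_add, ← Finset.sum_neg_distrib]
    congr 1
    exact Finset.sum_congr rfl fun j _ => by ring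
  le_time := fl.le_time
  lag := fl.lag
  hold := fl.hold
  gain := fl.gain

/-- Speed at which the perturbed maximum may grow, per unit of perturbation. -/
def drift (η h Λ : ℝ) : ℝ := (2 * Λ + 1) * (Λ / η * h + 1)

/-- A flow on `[τ, ∞)` with perturbations bounded by `β` and with states below `M` in the past of
`τ` that is relevant to it. -/
structure UpperWindow (η h t₀ Λ β M τ : ℝ) (a : ι → ι → ℝ) (x z g θ : ℝ → ι → ℝ) : Prop where
  flow : SampledFlow η h t₀ a x z g θ
  eta_pos : 0 < η
  h_nonneg : 0 ≤ h
  Lam_pos : 0 < Λ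
  beta_nonneg : 0 ≤ β
  start : t₀ ≤ τ - 2 * h
  degree : ∀ i, ∑ j, a i j ≤ Λ
  past : ∀ s ∈ Icc (τ - 2 * h) τ, ∀ i, x s i ≤ M
  err : ∀ s, τ - h ≤ s → ∀ i, |z s i - x (θ s i) i| ≤ β
  inp : ∀ s, τ - h ≤ s → ∀ i, |g s i| ≤ β

variable {Λ β M τ : ℝ}

theorem drift_pos (hη : 0 < η) (hh : 0 ≤ h) (hΛ : 0 < Λ) : 0 < drift η h Λ := by
  unfold drift; positivity

namespace UpperWindow

/-- Inserting the level `Y` turns differences of signals into sampled gaps below `Y`. The two signal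
errors cost `2 * Λ * β`, the external input costs `β`. -/
theorem rate_le_sampled (w : UpperWindow η h t₀ Λ β M τ a x z g θ) {s : ℝ} (hs : τ - h ≤ s)
    (Y : ℝ) (i : ι) :
    ∑ j, a i j * (z s j - z s i) + g s i ≤
      (∑ j, a i j) * (Y - x (θ s i) i) - ∑ j, a i j * (Y - x (θ s j) j) + (2 * Λ + 1) * β := by
  have h1 : ∑ j, a i j * (z s j - z s i) ≤
      ∑ j, (a i j * (Y - x (θ s i) i) - a i j * (Y - x (θ s j) j) + a i j * (2 * β)) := by
    refine Finset.sum_le_sum fun j _ => ?_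
    have hj := abs_le.1 (w.err s hs j)
    have hi := abs_le.1 (w.err s hs i)
    have := mul_le_mul_of_nonneg_left
      (show z s j - z s i ≤ (Y - x (θ s i) i) - (Y - x (θ s j) j) + 2 * β by linarith)
      (w.flow.nonneg i j)
    linarith
  rw [Finset.sum_add_distrib, Finset.sum_sub_distrib, ← Finset.sum_mul, ← Finset.sum_mul] at h1
  have h2 := (abs_le.1 (w.inp s hs i)).2
  have h3 := mul_le_mul_of_nonneg_right (w.degree i) (show 0 ≤ 2 * β by linarith [w.beta_nonneg])
  linarith

/-- This is where the triggering rule acts. Since the last sample the agent has moved up at rate at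
most its degree times the sampled gap, and degree times age is at most `1 - η`; the fraction `η` of
the gap survives. -/
theorem eta_mul_le (w : UpperWindow η h t₀ Λ β M τ a x z g θ) {t Y : ℝ} (ht : τ ≤ t)
    (hY : ∀ s ∈ Icc (τ - 2 * h) t, ∀ i, x s i ≤ Y) (i : ι) :
    η * (Y - x (θ t i) i) ≤ Y - x t i + (2 * Λ + 1) * h * β := by
  have hh := w.h_nonneg
  have hβ := w.beta_nonneg
  have hΛ := w.Lam_pos
  have hst := w.start
  have ht₀ : t₀ ≤ t := by linarith
  have hlag := w.flow.lag t ht₀ i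
  have hle := w.flow.le_time t ht₀ i
  set l := ∑ j, a i j with hl
  have key := le_add_mul_of_rightDeriv_le (f := fun s => x s i) (a := θ t i) (b := t) (t := t)
    (k := l * (Y - x (θ t i) i) + (2 * Λ + 1) * β)
    ((w.flow.cont i).mono fun s hs => mem_Ici.2 (by linarith [hs.1]))
    (fun s hs => w.flow.deriv s (by linarith [hs.1]) i)
    (fun s hs => by
      have hs₀ : t₀ ≤ s := by linarith [hs.1]
      have h1 := w.rate_le_sampled (s := s) (by linarith [hs.1]) Y i
      rw [w.flow.hold t ht₀ i s hs.1 hs.2.le] at h1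
      -- A time `s` since the last sample is up to `h` in the past, and the samples in use at `s`
      -- are up to `h` older: hence windows of length `2 * h`.
      have h2 : 0 ≤ ∑ j, a i j * (Y - x (θ s j) j) := Finset.sum_nonneg fun j _ =>
        mul_nonneg (w.flow.nonneg i j) (sub_nonneg.2 (hY _
          ⟨by linarith [w.flow.lag s hs₀ j, hs.1], by linarith [w.flow.le_time s hs₀ j, hs.2]⟩ j))
      linarith) ⟨hle, le_rfl⟩
  have hY' : 0 ≤ Y - x (θ t i) i := sub_nonneg.2 (hY _ ⟨by linarith, hle⟩ i)
  have hg := w.flow.gain t ht₀ i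
  have h3 := mul_le_mul_of_nonneg_right hg hY'
  have h4 : (2 * Λ + 1) * β * (t - θ t i) ≤ (2 * Λ + 1) * β * h :=
    mul_le_mul_of_nonneg_left (by linarith) (by positivity)
  rw [← hl] at h3
  linarith [add_mul (l * (Y - x (θ t i) i)) ((2 * Λ + 1) * β) (t - θ t i),
    mul_right_comm l (Y - x (θ t i) i) (t - θ t i), sub_mul 1 η (Y - x (θ t i) i),
    mul_right_comm (2 * Λ + 1) β h]

/-- By `eta_mul_le` the sampled gap is at most `1 / η` times the current one, up to the
perturbation. This yields an inequality that is linear in the current gap, with rate `Λ / η`. -/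
theorem rate_le (w : UpperWindow η h t₀ Λ β M τ a x z g θ) {t Y : ℝ} (ht : τ ≤ t)
    (hY : ∀ s ∈ Icc (τ - 2 * h) t, ∀ i, x s i ≤ Y) (i : ι) :
    ∑ j, a i j * (z t j - z t i) + g t i ≤
      Λ / η * (Y - x t i) + drift η h Λ * β - ∑ j, a i j * (Y - x (θ t j) j) := by
  have hη := w.eta_pos
  have hh := w.h_nonneg
  have hst := w.start
  have ht₀ : t₀ ≤ t := by linarith
  have h1 := w.rate_le_sampled (s := t) (by linarith) Y i
  have h2 := w.eta_mul_le ht hY i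
  have hY' : 0 ≤ Y - x (θ t i) i := sub_nonneg.2 (hY _
    ⟨by linarith [w.flow.lag t ht₀ i], w.flow.le_time t ht₀ i⟩ i)
  have h3 : (∑ j, a i j) * (Y - x (θ t i) i) ≤ Λ * (Y - x (θ t i) i) :=
    mul_le_mul_of_nonneg_right (w.degree i) hY'
  have h4 : Λ * (Y - x (θ t i) i) ≤ Λ / η * (Y - x t i + (2 * Λ + 1) * h * β) := by
    rw [div_mul_eq_mul_div, le_div_iff₀ hη, mul_assoc]
    exact mul_le_mul_of_nonneg_left (by linarith) w.Lam_pos.le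
  have h5 : drift η h Λ * β = Λ / η * ((2 * Λ + 1) * h * β) + (2 * Λ + 1) * β := by
    unfold drift; ring
  linarith [mul_add (Λ / η) (Y - x t i) ((2 * Λ + 1) * h * β)]

/-- An agent touching a rising barrier has gap zero, so `rate_le` leaves it only the speed `drift η
h Λ * β`. -/
theorem le_barrier (w : UpperWindow η h t₀ Λ β M τ a x z g θ) {t : ℝ} (ht : τ ≤ t) (i : ι) :
    x t i ≤ M + drift η h Λ * β * (t - τ) := by
  have hh := w.h_nonneg
  have hst := w.start
  have hD := (drift_pos w.eta_pos w.h_nonneg w.Lam_pos).le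
  have hβ := w.beta_nonneg
  -- The extra slope `ς` makes the barrier strictly faster than a touching agent; it is removed in
  -- the limit.
  suffices H : ∀ ς > 0, x t i ≤ M + drift η h Λ * β * (t - τ) + ς * (t - τ) by
    refine le_of_forall_pos_le_add fun e he => ?_
    have hp : 0 < t - τ + 1 := by linarith
    refine (H (e / (t - τ + 1)) (by positivity)).trans ?_
    gcongr
    rw [div_mul_eq_mul_div, div_le_iff₀ hp]
    nlinarith
  intro ς hς
  set k := drift η h Λ * β + ς with hk
  have hk0 : 0 < k := by positivity
  have hB : ∀ s : ℝ, HasDerivAt (fun s => M + k * (s - τ)) k s := fun s => by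
    simpa using (((hasDerivAt_id s).sub_const τ).const_mul k).const_add M
  have := forall_le_barrier (x := x) (u := fun s i => ∑ j, a i j * (z s j - z s i) + g s i)
    (B := fun s => M + k * (s - τ)) (B' := fun _ => k) (a := τ) (b := t)
    (fun i => (w.flow.cont i).mono fun s hs => mem_Ici.2 (by linarith [hs.1]))
    (fun s hs i => w.flow.deriv s (by linarith [hs.1]) i) hB
    (fun i => by simpa using w.past τ ⟨by linarith, le_rfl⟩ i)
    (fun s hs hbelow i hi => by
      have hY : ∀ r ∈ Icc (τ - 2 * h) s, ∀ i, x r i ≤ M + k * (s - τ) := by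
        intro r hr j
        rcases le_total r τ with hrτ | hrτ
        · have := w.past r ⟨hr.1, hrτ⟩ j
          have : 0 ≤ k * (s - τ) := mul_nonneg hk0.le (by linarith [hs.1])
          linarith
        · have h1 := hbelow r ⟨hrτ, hr.2⟩ j
          have : k * (r - τ) ≤ k * (s - τ) :=
            mul_le_mul_of_nonneg_left (by linarith [hr.2]) hk0.le
          linarith
      have h1 := w.rate_le hs.1 hY i
      have hs₀ : t₀ ≤ s := by linarith [hs.1]
      have h2 : 0 ≤ ∑ j, a i j * (M + k * (s - τ) - x (θ s j) j) := Finset.sum_nonneg fun j _ =>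
        mul_nonneg (w.flow.nonneg i j) (sub_nonneg.2 (hY _
          ⟨by linarith [w.flow.lag s hs₀ j, hs.1], w.flow.le_time s hs₀ j⟩ j))
      have h3 : M + k * (s - τ) - x s i = 0 := by linarith
      rw [h3, mul_zero] at h1
      linarith) t ⟨ht, le_rfl⟩ i
  calc x t i ≤ M + k * (t - τ) := this
    _ = _ := by rw [hk]; ring

theorem le_of_mem (w : UpperWindow η h t₀ Λ β M τ a x z g θ) {T s : ℝ} (hT : 0 ≤ T)
    (hs : s ∈ Icc (τ - 2 * h) (τ + T)) (i : ι) : x s i ≤ M + drift η h Λ * β * T := by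
  have hD := (drift_pos w.eta_pos w.h_nonneg w.Lam_pos).le
  have hβ := w.beta_nonneg
  rcases le_total s τ with hsτ | hsτ
  · have := w.past s ⟨hs.1, hsτ⟩ i
    have : 0 ≤ drift η h Λ * β * T := by positivity
    linarith
  · have h1 := w.le_barrier hsτ i
    have : drift η h Λ * β * (s - τ) ≤ drift η h Λ * β * T :=
      mul_le_mul_of_nonneg_left (by linarith [hs.2]) (by positivity)
    linarith

/-- The distance of `x_i` to the upper bound of the window obeys a linear differential
inequality. -/
theorem comparison (w : UpperWindow η h t₀ Λ β M τ a x z g θ) {T p s₀ t : ℝ} (hT : 0 ≤ T)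
    (hs₀ : τ ≤ s₀) (hs₀t : s₀ ≤ t) (ht : t ≤ τ + T) (i : ι)
    (hp : ∀ s ∈ Ico s₀ t, p ≤ ∑ j, a i j * (M + drift η h Λ * β * T - x (θ s j) j)) :
    (p - drift η h Λ * β) / (Λ / η) +
      ((M + drift η h Λ * β * T - x s₀ i) - (p - drift η h Λ * β) / (Λ / η)) *
        Real.exp (-(Λ / η) * (t - s₀)) ≤ M + drift η h Λ * β * T - x t i := by
  have hh := w.h_nonneg
  have hst := w.start
  refine linear_comparison (y := fun s => M + drift η h Λ * β * T - x s i)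
    (y' := fun s => -(∑ j, a i j * (z s j - z s i) + g s i)) (div_pos w.Lam_pos w.eta_pos)
    (continuousOn_const.sub ((w.flow.cont i).mono fun s hs => mem_Ici.2 (by linarith [hs.1])))
    (fun s hs => (w.flow.deriv s (by linarith [hs.1]) i).const_sub _)
    (fun s hs => ?_) ⟨hs₀t, le_rfl⟩
  have h1 := w.rate_le (t := s) (Y := M + drift η h Λ * β * T) (by linarith [hs.1])
    (fun r hr j => w.le_of_mem hT ⟨hr.1, by linarith [hr.2, hs.2]⟩ j) i
  have h2 := hp s hs
  linarith

end UpperWindow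

theorem exists_crossing {α : Type*} {r : α → α → Prop} {P : α → Prop} {u v : α}
    (huv : Relation.ReflTransGen r u v) (hu : ¬ P u) (hv : P v) : ∃ i j, r i j ∧ ¬ P i ∧ P j := by
  induction huv using Relation.ReflTransGen.head_induction_on with
  | refl => exact absurd hv hu
  | @head u w huw _ ih =>
    by_cases hw : P w
    · exact ⟨u, w, huw, hu, hw⟩
    · exact ih hw

end Flow

/-! ### Contraction of the spread -/

/-- A low value of the root spreads to at least `k + 1` agents within time `k * (h + 1)`. -/
theorem exists_low_agents {η ε h Λ T : ℝ} (hη : 0 < η) (hε : 0 < ε) (hh : 0 ≤ h) (hΛ : 0 < Λ)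
    (hT : 0 ≤ T) (k : ℕ) :
    ∃ κ C : ℝ, 0 < κ ∧ κ ≤ 1 ∧ 0 ≤ C ∧ ∀ (ι : Type) [Fintype ι] (t₀ β M τ W : ℝ)
      (a : ι → ι → ℝ) (x z g θ : ℝ → ι → ℝ), UpperWindow η h t₀ Λ β M τ a x z g θ → 0 ≤ W →
      ∀ r : ι, (∀ i, Relation.ReflTransGen (fun i j => ε ≤ a i j) i r) → x τ r ≤ M - W / 2 →
      ∃ G : Finset ι, r ∈ G ∧ (k + 1 ≤ G.card ∨ G = Finset.univ) ∧
        ∀ i ∈ G, ∀ t ∈ Icc (τ + k * (h + 1)) (τ + T),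
          κ * W - C * β ≤ M + drift η h Λ * β * T - x t i := by
  classical
  have hD := (drift_pos hη hh hΛ).le
  set lam := Λ / η with hlam
  have hlam0 : 0 < lam := div_pos hΛ hη
  induction k with
  | zero =>
    -- The root starts with gap at least `W / 2`, and a gap decays at rate at most `lam` during time
    -- `T`, up to the perturbation.
    refine ⟨Real.exp (-lam * T) / 2, drift η h Λ / lam, by positivity, ?_, by positivity, ?_⟩
    · have : Real.exp (-lam * T) ≤ 1 := Real.exp_le_one_iff.2 (by nlinarith)
      linarith
    intro ι _ t₀ β M τ W a x z g θ w hW r _ hr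
    have hβ := w.beta_nonneg
    refine ⟨{r}, by simp, Or.inl (by simp), ?_⟩
    intro i hi t ht
    obtain rfl : i = r := by simpa using hi
    have ht1 : τ ≤ t := by simpa using ht.1
    have h1 := w.comparison (p := 0) hT le_rfl ht1 ht.2 i (fun s hs => by
      refine Finset.sum_nonneg fun j _ => mul_nonneg (w.flow.nonneg i j) (sub_nonneg.2 ?_)
      have hs₀ : t₀ ≤ s := by linarith [w.start, hs.1]
      exact w.le_of_mem hT ⟨by linarith [w.flow.lag s hs₀ j, hs.1],
        by linarith [w.flow.le_time s hs₀ j, hs.2, ht.2]⟩ j)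
    rw [← hlam] at h1
    have hE : Real.exp (-lam * T) ≤ Real.exp (-lam * (t - τ)) :=
      Real.exp_le_exp.2 (by nlinarith [ht.2])
    have h2 : W / 2 ≤ M + drift η h Λ * β * T - x τ i - (0 - drift η h Λ * β) / lam := by
      have : 0 ≤ drift η h Λ * β * T := by positivity
      have : 0 ≤ drift η h Λ * β / lam := by positivity
      have : (0 - drift η h Λ * β) / lam = -(drift η h Λ * β / lam) := by ring
      linarith
    have h3 : W / 2 * Real.exp (-lam * T) ≤
        (M + drift η h Λ * β * T - x τ i - (0 - drift η h Λ * β) / lam) *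
          Real.exp (-lam * (t - τ)) :=
      mul_le_mul h2 hE (Real.exp_pos _).le (by linarith)
    have h4 : (0 - drift η h Λ * β) / lam = -(drift η h Λ / lam * β) := by ring
    linarith
  | succ k ih =>
    obtain ⟨κ, C, hκ, hκ1, hC, ih⟩ := ih
    set ν := (1 - Real.exp (-lam)) / lam with hν
    have hν0 : 0 < ν := div_pos (sub_pos.2 (Real.exp_lt_one_iff.2 (by linarith))) hlam0
    -- An agent pulled through an edge of weight `ε` by one with gap `κ * W` solves `y' ≥ ε * κ * W
    -- - lam * y` up to perturbation; `ν` is the response to a unit input after unit time.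
    refine ⟨min κ (ε * κ * ν), C + (ε * C + drift η h Λ) / lam, by positivity,
      (min_le_left _ _).trans hκ1, by positivity, ?_⟩
    intro ι _ t₀ β M τ W a x z g θ w hW r hreach hr
    have hβ := w.beta_nonneg
    obtain ⟨G, hrG, hcard, hG⟩ := ih ι t₀ β M τ W a x z g θ w hW r hreach hr
    have hold : ∀ i ∈ G, ∀ t ∈ Icc (τ + (k + 1 : ℕ) * (h + 1)) (τ + T),
        min κ (ε * κ * ν) * W - (C + (ε * C + drift η h Λ) / lam) * β ≤
          M + drift η h Λ * β * T - x t i := by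
      intro i hi t ht
      refine le_trans ?_ (hG i hi t ⟨?_, ht.2⟩)
      · have h1 : min κ (ε * κ * ν) * W ≤ κ * W := mul_le_mul_of_nonneg_right (min_le_left _ _) hW
        have h2 : C * β ≤ (C + (ε * C + drift η h Λ) / lam) * β :=
          mul_le_mul_of_nonneg_right (le_add_of_nonneg_right (by positivity)) hβ
        linarith
      · have := ht.1
        push_cast at this
        linarith
    by_cases hGu : G = Finset.univ
    · exact ⟨G, hrG, Or.inr hGu, hold⟩
    obtain ⟨u, hu⟩ : ∃ u, u ∉ G := by
      by_contra! hcon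
      exact hGu (Finset.eq_univ_iff_forall.2 hcon)
    obtain ⟨i, j, hij, hi, hj⟩ := exists_crossing (P := fun v => v ∈ G) (hreach u) hu hrG
    refine ⟨insert i G, by simp [hrG], Or.inl ?_, ?_⟩
    · rw [Finset.card_insert_of_notMem hi]
      rcases hcard with hc | hc
      · omega
      · exact absurd hc hGu
    intro v hv t ht
    rcases Finset.mem_insert.1 hv with rfl | hv
    swap
    · exact hold v hv t ht
    have ht1 := ht.1
    push_cast at ht1
    -- After the waiting time `h`, all samples in use date from the period in which `G` is already
    -- low. A full unit of time then remains before `t`.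
    set s₀ := τ + k * (h + 1) + h with hs₀
    have hk0 : (0 : ℝ) ≤ k * (h + 1) := by positivity
    have h1 := w.comparison (p := ε * (κ * W - C * β)) (s₀ := s₀) hT (by linarith)
      (by linarith) ht.2 v (fun s hs => by
        have hst₀ : t₀ ≤ s := by linarith [w.start, hs.1]
        have hin : ∀ l, θ s l ∈ Icc (τ + k * (h + 1)) (τ + T) := fun l =>
          ⟨by linarith [w.flow.lag s hst₀ l, hs.1], by
            linarith [w.flow.le_time s hst₀ l, hs.2, ht.2]⟩
        have hnn : ∀ l, 0 ≤ M + drift η h Λ * β * T - x (θ s l) l := fun l =>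
          sub_nonneg.2 (w.le_of_mem hT ⟨by linarith [(hin l).1], (hin l).2⟩ l)
        calc ε * (κ * W - C * β)
            ≤ ε * (M + drift η h Λ * β * T - x (θ s j) j) :=
              mul_le_mul_of_nonneg_left (hG j hj _ (hin j)) hε.le
          _ ≤ a v j * (M + drift η h Λ * β * T - x (θ s j) j) :=
              mul_le_mul_of_nonneg_right hij (hnn j)
          _ ≤ _ := Finset.single_le_sum
              (f := fun l => a v l * (M + drift η h Λ * β * T - x (θ s l) l))
              (fun l _ => mul_nonneg (w.flow.nonneg v l) (hnn l)) (Finset.mem_univ j))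
    rw [← hlam] at h1
    have hy : 0 ≤ M + drift η h Λ * β * T - x s₀ v :=
      sub_nonneg.2 (w.le_of_mem hT ⟨by linarith, by linarith [ht.2]⟩ v)
    set E := Real.exp (-lam * (t - s₀)) with hE
    have hE0 : 0 < E := Real.exp_pos _
    have hE1 : E ≤ Real.exp (-lam) := Real.exp_le_exp.2 (by nlinarith)
    have hyE : 0 ≤ (M + drift η h Λ * β * T - x s₀ v) * E := mul_nonneg hy hE0.le
    have h2 : min κ (ε * κ * ν) * W ≤ ε * κ * W / lam * (1 - E) := by
      calc min κ (ε * κ * ν) * W ≤ ε * κ * ν * W :=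
            mul_le_mul_of_nonneg_right (min_le_right _ _) hW
        _ = ε * κ * W / lam * (1 - Real.exp (-lam)) := by rw [hν]; ring
        _ ≤ _ := mul_le_mul_of_nonneg_left (by linarith) (by positivity)
    have h3 : (ε * C + drift η h Λ) * β / lam * (1 - E) ≤
        (C + (ε * C + drift η h Λ) / lam) * β := by
      calc (ε * C + drift η h Λ) * β / lam * (1 - E)
          ≤ (ε * C + drift η h Λ) * β / lam * 1 :=
            mul_le_mul_of_nonneg_left (by linarith) (by positivity)
        _ = (ε * C + drift η h Λ) / lam * β := by ring
        _ ≤ _ := mul_le_mul_of_nonneg_right (le_add_of_nonneg_left hC) hβ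
    have h4 : (ε * (κ * W - C * β) - drift η h Λ * β) / lam +
        ((M + drift η h Λ * β * T - x s₀ v) - (ε * (κ * W - C * β) - drift η h Λ * β) / lam) * E
        = ε * κ * W / lam * (1 - E) - (ε * C + drift η h Λ) * β / lam * (1 - E)
          + (M + drift η h Λ * β * T - x s₀ v) * E := by ring
    linarith


/-- A low value of the root pulls down the upper bound of the whole flow. -/
theorem upper_contraction (N : ℕ) {η ε h Λ T : ℝ} (hη : 0 < η) (hε : 0 < ε) (hh : 0 ≤ h)
    (hΛ : 0 < Λ) (hT : N * (h + 1) + 2 * h ≤ T) :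
    ∃ κ C : ℝ, 0 < κ ∧ κ ≤ 1 ∧ 0 ≤ C ∧ ∀ (ι : Type) [Fintype ι], Fintype.card ι ≤ N →
      ∀ (t₀ β M τ W : ℝ) (a : ι → ι → ℝ) (x z g θ : ℝ → ι → ℝ),
      UpperWindow η h t₀ Λ β M τ a x z g θ → 0 ≤ W →
      ∀ r : ι, (∀ i, Relation.ReflTransGen (fun i j => ε ≤ a i j) i r) → x τ r ≤ M - W / 2 →
      ∀ t ∈ Icc (τ + T - 2 * h) (τ + T), ∀ i, x t i ≤ M - κ * W + C * β := by
  have hT0 : 0 ≤ T := le_trans (by positivity) hT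
  obtain ⟨κ, C, hκ, hκ1, hC, H⟩ := exists_low_agents hη hε hh hΛ hT0 N
  refine ⟨κ, C + drift η h Λ * T, hκ, hκ1, ?_, ?_⟩
  · have := drift_pos hη hh hΛ
    positivity
  intro ι _ hcard t₀ β M τ W a x z g θ w hW r hreach hr t ht i
  obtain ⟨G, -, hG, hlow⟩ := H ι t₀ β M τ W a x z g θ w hW r hreach hr
  have hGu : G = Finset.univ := by
    rcases hG with hG | hG
    · have := G.card_le_univ
      omega
    · exact hG
  have := hlow i (by simp [hGu]) t ⟨by linarith [ht.1], ht.2⟩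
  linarith [add_mul C (drift η h Λ * T) β, mul_right_comm (drift η h Λ) β T]

/-- The spread of a flow whose agents all have a path to a root along edges of weight at least `ε`
decays exponentially to a multiple of the perturbation, with constants that depend only on the
bounds on the flow. -/
theorem SampledFlow.expBdd (N : ℕ) {η ε h Λ : ℝ} (hη : 0 < η) (hε : 0 < ε) (hh : 0 ≤ h)
    (hΛ : 0 < Λ) :
    ∃ C c₀ : ℝ, 0 < C ∧ 0 < c₀ ∧ ∀ (ι : Type) [Fintype ι], Fintype.card ι ≤ N →
      ∀ (t₀ : ℝ) (a : ι → ι → ℝ) (x z g θ : ℝ → ι → ℝ), SampledFlow η h t₀ a x z g θ →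
      (∀ i, ∑ j, a i j ≤ Λ) →
      ∀ r : ι, (∀ i, Relation.ReflTransGen (fun i j => ε ≤ a i j) i r) →
      ∀ c, 0 < c → c ≤ c₀ → ∀ b, 0 ≤ b →
      (∀ i, ExpBdd c b (fun t => |z t i - x (θ t i) i|)) → (∀ i, ExpBdd c b (fun t => |g t i|)) →
      ∀ i j, ExpBdd c (C * b) (fun t => |x t i - z t j|) := by
  set T := N * (h + 1) + 2 * h + 1 with hT
  have hT0 : 0 < T := by positivity
  obtain ⟨κ, C, hκ, hκ1, hC, H⟩ := upper_contraction N (T := T) hη hε hh hΛ (by linarith)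
  have hD := drift_pos hη hh hΛ
  set D := drift η h Λ with hDdef
  set C₁ := C + D * T with hC₁
  have hC₁0 : 0 < C₁ := by positivity
  -- `C₁ / κ * b` is the fixed point of `w ↦ (1 - κ) * w + C₁ * b`; `2 * D * T` is the drift of both
  -- ends within a period, and 1 the signal error. The rate bound `κ / (2 * T)` ensures `exp (-c *
  -- T) ≥ 1 - κ / 2`, so half of the contraction can absorb the decaying part of the perturbation.
  refine ⟨C₁ / κ + 2 * D * T + 1, κ / (2 * T), by positivity, by positivity, ?_⟩
  intro ι _ hcard t₀ a x z g θ fl hdeg r hreach c hc hcc b hb herr hinp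
  obtain ⟨K₁, hK₁, hev₁⟩ := ExpBdd.exists_forall_window hc.le herr h
  obtain ⟨K₂, hK₂, hev₂⟩ := ExpBdd.exists_forall_window hc.le hinp h
  set K := K₁ + K₂ with hK
  have hK0 : 0 ≤ K := by positivity
  obtain ⟨τ₀, hτ₀⟩ := eventually_atTop.1 ((hev₁.and hev₂).and (eventually_ge_atTop (t₀ + 2 * h)))
  set β : ℝ → ℝ := fun τ => b + K * Real.exp (-c * τ) with hβ
  have hβ0 : ∀ τ, 0 ≤ β τ := fun τ => by positivity
  have hwin : ∀ τ, τ₀ ≤ τ → ∀ m M, (∀ s ∈ Icc (τ - 2 * h) τ, ∀ i, x s i ∈ Icc m M) →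
      UpperWindow η h t₀ Λ (β τ) M τ a x z g θ ∧
      UpperWindow η h t₀ Λ (β τ) (-m) τ a (fun t i => -x t i) (fun t i => -z t i)
        (fun t i => -g t i) θ := by
    intro τ hτ m M hmM
    obtain ⟨⟨h1, h2⟩, h3⟩ := hτ₀ τ hτ
    have hE := (Real.exp_pos (-c * τ)).le
    have hK₁K : K₁ * Real.exp (-c * τ) ≤ K * Real.exp (-c * τ) :=
      mul_le_mul_of_nonneg_right (by linarith) hE
    have hK₂K : K₂ * Real.exp (-c * τ) ≤ K * Real.exp (-c * τ) :=
      mul_le_mul_of_nonneg_right (by linarith) hE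
    have he : ∀ s, τ - h ≤ s → ∀ i, |z s i - x (θ s i) i| ≤ β τ := fun s hs i => by
      linarith [h1 s hs i]
    have hg : ∀ s, τ - h ≤ s → ∀ i, |g s i| ≤ β τ := fun s hs i => by linarith [h2 s hs i]
    refine ⟨⟨fl, hη, hh, hΛ, hβ0 τ, by linarith, hdeg, fun s hs i => (hmM s hs i).2, he, hg⟩,
      ⟨fl.neg, hη, hh, hΛ, hβ0 τ, by linarith, hdeg, fun s hs i => neg_le_neg (hmM s hs i).1,
        fun s hs i => ?_, fun s hs i => ?_⟩⟩
    · have := he s hs i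
      rwa [← neg_sub_neg, abs_sub_comm] at this
    · simpa using hg s hs i
  have hstep : ∀ τ, τ₀ ≤ τ → ∀ m M, m ≤ M → (∀ s ∈ Icc (τ - 2 * h) τ, ∀ i, x s i ∈ Icc m M) →
      ∃ m' M', m' ≤ M' ∧ (∀ s ∈ Icc (τ + T - 2 * h) (τ + T), ∀ i, x s i ∈ Icc m' M') ∧
        M' - m' ≤ (1 - κ) * (M - m) + C₁ * β τ := by
    intro τ hτ m M hle hmM
    obtain ⟨wu, wl⟩ := hwin τ hτ m M hmM
    have hW : 0 ≤ M - m := by linarith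
    have hne : ∀ m' M', (∀ s ∈ Icc (τ + T - 2 * h) (τ + T), ∀ i, x s i ∈ Icc m' M') → m' ≤ M' :=
      fun m' M' hx => (hx (τ + T) ⟨by linarith, le_rfl⟩ r).1.trans
        (hx (τ + T) ⟨by linarith, le_rfl⟩ r).2
    -- A root in the lower half pulls the maximum down; a root in the upper half does the same for
    -- the reflected flow.
    rcases le_total (x τ r) ((m + M) / 2) with hr | hr
    · have hup := H ι hcard t₀ (β τ) M τ (M - m) a x z g θ wu hW r hreach (by linarith)
      have hx : ∀ s ∈ Icc (τ + T - 2 * h) (τ + T), ∀ i,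
          x s i ∈ Icc (m - D * β τ * T) (M - κ * (M - m) + C * β τ) := fun s hs i =>
        ⟨by linarith [wl.le_of_mem hT0.le ⟨by linarith [hs.1], hs.2⟩ i], hup s hs i⟩
      refine ⟨_, _, hne _ _ hx, hx, le_of_eq ?_⟩
      rw [hC₁]; ring
    · have hup := H ι hcard t₀ (β τ) (-m) τ (M - m) a _ _ _ θ wl hW r hreach (by linarith)
      have hx : ∀ s ∈ Icc (τ + T - 2 * h) (τ + T), ∀ i,
          x s i ∈ Icc (m + κ * (M - m) - C * β τ) (M + D * β τ * T) := fun s hs i =>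
        ⟨by linarith [hup s hs i], wu.le_of_mem hT0.le ⟨by linarith [hs.1], hs.2⟩ i⟩
      refine ⟨_, _, hne _ _ hx, hx, le_of_eq ?_⟩
      rw [hC₁]; ring
  obtain ⟨B, hB0, hB⟩ : ∃ B : ℝ, 0 ≤ B ∧ ∀ s ∈ Icc (τ₀ - 2 * h) τ₀, ∀ i, x s i ∈ Icc (-B) B := by
    have hbd : ∀ i, ∃ B : ℝ, ∀ s ∈ Icc (τ₀ - 2 * h) τ₀, ‖x s i‖ ≤ B := fun i =>
      isCompact_Icc.exists_bound_of_continuousOn ((fl.cont i).mono fun s hs => mem_Ici.2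
        (by linarith [hs.1, (hτ₀ τ₀ le_rfl).2]))
    choose B hB using hbd
    refine ⟨∑ i, |B i|, Finset.sum_nonneg fun i _ => abs_nonneg _, fun s hs i => ?_⟩
    have h1 : |x s i| ≤ ∑ i, |B i| := (hB i s hs).trans ((le_abs_self _).trans
      (Finset.single_le_sum (f := fun i => |B i|) (fun i _ => abs_nonneg _) (Finset.mem_univ i)))
    exact abs_le.1 h1
  -- The first term gives `C₁ * K ≤ κ / 2 * K'`, needed in the iteration; the second covers the
  -- initial width `2 * B`.
  set K' := 2 * C₁ * K / κ + 2 * B * Real.exp (c * τ₀) with hK'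
  have hK'0 : 0 ≤ K' := by positivity
  have hiter : ∀ k : ℕ, ∃ m M, m ≤ M ∧
      (∀ s ∈ Icc (τ₀ + k * T - 2 * h) (τ₀ + k * T), ∀ i, x s i ∈ Icc m M) ∧
      M - m ≤ C₁ / κ * b + K' * Real.exp (-c * (τ₀ + k * T)) := by
    intro k
    induction k with
    | zero =>
      refine ⟨-B, B, by linarith, by simpa using hB, ?_⟩
      have h1 : Real.exp (c * τ₀) * Real.exp (-c * τ₀) = 1 := by rw [← Real.exp_add]; simp
      have h2 : K' * Real.exp (-c * τ₀) = 2 * C₁ * K / κ * Real.exp (-c * τ₀) + 2 * B := by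
        rw [hK', add_mul, mul_assoc (2 * B), h1, mul_one]
      have h3 : 0 ≤ 2 * C₁ * K / κ * Real.exp (-c * τ₀) := by positivity
      have h4 : 0 ≤ C₁ / κ * b := by positivity
      simp only [Nat.cast_zero, zero_mul, add_zero]
      linarith
    | succ k ih =>
      obtain ⟨m, M, hle, hmM, hwid⟩ := ih
      have hkT : 0 ≤ (k : ℝ) * T := by positivity
      obtain ⟨m', M', hle', hx, hw⟩ := hstep (τ₀ + k * T) (by linarith) m M hle hmM
      have hcast : τ₀ + ((k + 1 : ℕ) : ℝ) * T = τ₀ + k * T + T := by push_cast; ring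
      refine ⟨m', M', hle', by rw [hcast]; exact hx, hw.trans ?_⟩
      rw [hcast]
      set E := Real.exp (-c * (τ₀ + k * T)) with hE
      have hE0 : 0 ≤ E := (Real.exp_pos _).le
      have hsplit : Real.exp (-c * (τ₀ + k * T + T)) = E * Real.exp (-c * T) := by
        rw [hE, ← Real.exp_add]; ring_nf
      have hexp : 1 - κ / 2 ≤ Real.exp (-c * T) := by
        have h1 := Real.add_one_le_exp (-c * T)
        have h2 : c * T ≤ κ / (2 * T) * T := mul_le_mul_of_nonneg_right hcc hT0.le
        have h3 : κ / (2 * T) * T = κ / 2 := by field_simp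
        linarith
      have h1 : (1 - κ) * (M - m) ≤ (1 - κ) * (C₁ / κ * b + K' * E) :=
        mul_le_mul_of_nonneg_left hwid (by linarith)
      have h2 : K' * E * (1 - κ / 2) ≤ K' * E * Real.exp (-c * T) :=
        mul_le_mul_of_nonneg_left hexp (by positivity)
      have h3 : C₁ * K ≤ κ / 2 * K' := by
        have : κ / 2 * K' = C₁ * K + κ * B * Real.exp (c * τ₀) := by
          rw [hK']; field_simp
        have : 0 ≤ κ * B * Real.exp (c * τ₀) := by positivity
        linarith
      have h4 := mul_le_mul_of_nonneg_right h3 hE0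
      have h5 : (1 - κ) * (C₁ / κ * b) + C₁ * b = C₁ / κ * b := by field_simp; ring
      rw [hsplit]
      simp only [hβ]
      rw [← hE]
      linarith [mul_add (1 - κ) (C₁ / κ * b) (K' * E), mul_add C₁ b (K * E)]
  intro i j
  refine ⟨(K' + (2 * D * T + 1) * K) * Real.exp (c * T), by positivity, ?_⟩
  filter_upwards [eventually_ge_atTop τ₀] with t ht
  set k := ⌊(t - τ₀) / T⌋₊ with hk
  have hk1 : τ₀ + k * T ≤ t := by
    have := Nat.floor_le (div_nonneg (sub_nonneg.2 ht) hT0.le)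
    rw [le_div_iff₀ hT0] at this
    linarith
  have hk2 : t ≤ τ₀ + k * T + T := by
    have := (Nat.lt_floor_add_one ((t - τ₀) / T)).le
    rw [div_le_iff₀ hT0] at this
    linarith
  have hkT : 0 ≤ (k : ℝ) * T := by positivity
  obtain ⟨m, M, -, hmM, hwid⟩ := hiter k
  set τ := τ₀ + k * T with hτ
  obtain ⟨wu, wl⟩ := hwin τ (by linarith) m M hmM
  have ht₀ : t₀ ≤ t := by linarith [wu.start]
  have hin : ∀ s ∈ Icc (τ - 2 * h) (τ + T), ∀ i,
      x s i ∈ Icc (m - D * β τ * T) (M + D * β τ * T) := fun s hs i =>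
    ⟨by linarith [wl.le_of_mem hT0.le hs i], wu.le_of_mem hT0.le hs i⟩
  have h1 := hin t ⟨by linarith, hk2⟩ i
  have h2 := hin (θ t j) ⟨by linarith [fl.lag t ht₀ j], by linarith [fl.le_time t ht₀ j]⟩ j
  have h3 := abs_le.1 (wu.err t (by linarith) j)
  have h4 : |x t i - z t j| ≤ M - m + (2 * D * T + 1) * β τ := by
    rw [abs_le]
    constructor <;> linarith [h1.1, h1.2, h2.1, h2.2, mul_right_comm D (β τ) T,
      add_mul (2 * D * T) 1 (β τ), mul_assoc 2 (D * T) (β τ), mul_assoc 2 D T]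
  have h5 : Real.exp (-c * τ) ≤ Real.exp (c * T) * Real.exp (-c * t) := by
    rw [← Real.exp_add]
    exact Real.exp_le_exp.2 (by nlinarith)
  have h6 : (K' + (2 * D * T + 1) * K) * Real.exp (-c * τ) ≤
      (K' + (2 * D * T + 1) * K) * (Real.exp (c * T) * Real.exp (-c * t)) :=
    mul_le_mul_of_nonneg_left h5 (by positivity)
  have h7 : (2 * D * T + 1) * β τ = (2 * D * T + 1) * b + (2 * D * T + 1) * K * Real.exp (-c * τ) := by
    simp only [hβ]; ring
  calc |x t i - z t j| ≤ M - m + (2 * D * T + 1) * β τ := h4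
    _ ≤ (C₁ / κ + 2 * D * T + 1) * b +
        (K' + (2 * D * T + 1) * K) * (Real.exp (c * T) * Real.exp (-c * t)) := by linarith
    _ = _ := by ring

/-! ### Elimination of agents -/

/-- Quantitative maximum principle: if every agent of `E` has a path out of `E` along edges of
weight at least `ε`, then the constant depends only on `ε` and the number of agents. -/
theorem maximum_principle (N : ℕ) {ε : ℝ} (hε : 0 < ε) :
    ∃ C : ℝ, 0 < C ∧ ∀ (ι : Type) [Fintype ι], Fintype.card ι ≤ N → ∀ (a : ι → ι → ℝ),
      (∀ i j, 0 ≤ a i j) → (∀ i j, a i j ≤ 1) → ∀ (E : Finset ι),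
      (∀ e ∈ E, ∃ s, s ∉ E ∧ Relation.ReflTransGen (fun i j => ε ≤ a i j) e s) →
      ∀ (u : ι → ℝ) (f : ℝ), 0 ≤ f → (∀ s, s ∉ E → u s ≤ 0) →
      (∀ e ∈ E, ∑ k, a e k * (u e - u k) ≤ f) → ∀ i, u i ≤ C * f := by
  classical
  -- Starting from a maximum point, the set `G` of nearly maximal agents grows by one agent per step
  -- until it meets the complement of `E`, where `u ≤ 0`. With more than `N` agents it would be too
  -- large.
  have step : ∀ k : ℕ, ∃ C : ℝ, 0 ≤ C ∧ ∀ (ι : Type) [Fintype ι], Fintype.card ι ≤ N →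
      ∀ (a : ι → ι → ℝ),
      (∀ i j, 0 ≤ a i j) → (∀ i j, a i j ≤ 1) → ∀ (E : Finset ι),
      (∀ e ∈ E, ∃ s, s ∉ E ∧ Relation.ReflTransGen (fun i j => ε ≤ a i j) e s) →
      ∀ (u : ι → ℝ) (f : ℝ), 0 ≤ f → (∀ s, s ∉ E → u s ≤ 0) →
      (∀ e ∈ E, ∑ k, a e k * (u e - u k) ≤ f) → ∀ i, (∀ j, u j ≤ u i) →
      u i ≤ C * f ∨ ∃ G : Finset ι, k + 1 ≤ G.card ∧ ∀ v ∈ G, u i - C * f ≤ u v := by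
    intro k
    induction k with
    | zero =>
      exact ⟨0, le_rfl, fun ι _ _ a _ _ E _ u f _ _ _ i _ => Or.inr ⟨{i}, by simp, by simp⟩⟩
    | succ k ih =>
      obtain ⟨C, hC, ih⟩ := ih
      have hCC : C ≤ C + (1 + N * C) / ε := le_add_of_nonneg_right (by positivity)
      refine ⟨C + (1 + N * C) / ε, by positivity, ?_⟩
      intro ι _ hcard a ha ha1 E hE u f hf hu hL i hi
      have hCf : C * f ≤ (C + (1 + N * C) / ε) * f := mul_le_mul_of_nonneg_right hCC hf
      rcases ih ι hcard a ha ha1 E hE u f hf hu hL i hi with h | ⟨G, hG, hlow⟩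
      · exact Or.inl (h.trans hCf)
      by_cases hGE : ∃ v ∈ G, v ∉ E
      · obtain ⟨v, hv, hvE⟩ := hGE
        exact Or.inl (by linarith [hlow v hv, hu v hvE])
      push Not at hGE
      obtain ⟨v, hv⟩ : G.Nonempty := Finset.card_pos.1 (by omega)
      obtain ⟨s, hsE, hvs⟩ := hE v (hGE v hv)
      obtain ⟨p, j, hpj, hp, hj⟩ := exists_crossing (P := fun w => w ∉ G) hvs (by simpa using hv)
        (fun h => hsE (hGE s h))
      simp only [not_not] at hp
      refine Or.inr ⟨insert j G, by rw [Finset.card_insert_of_notMem hj]; omega, ?_⟩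
      intro w hw
      rcases Finset.mem_insert.1 hw with rfl | hw
      swap
      · linarith [hlow w hw]
      have hp1 := hlow p hp
      have hCf0 : 0 ≤ C * f := by positivity
      by_cases hcmp : u p ≤ u w
      · linarith
      push Not at hcmp
      have hsum := hL p (hGE p hp)
      -- As `u p` is within `C * f` of the maximum and weights are at most 1, no term is below `-(C
      -- * f)`. The one strong edge can therefore only carry a drop of at most `(1 + N * C) / ε *
      -- f`.
      have hterm : ∀ l, -(C * f) ≤ a p l * (u p - u l) := fun l => by
        have h1 : -(C * f) ≤ u p - u l := by linarith [hi l]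
        have h2 := mul_le_mul_of_nonneg_left h1 (ha p l)
        have h3 := mul_le_mul_of_nonneg_right (ha1 p l) hCf0
        linarith
      have h1 : ε * (u p - u w) - N * (C * f) ≤ ∑ l, a p l * (u p - u l) := by
        rw [← Finset.add_sum_erase _ _ (Finset.mem_univ w)]
        have h2 : ε * (u p - u w) ≤ a p w * (u p - u w) :=
          mul_le_mul_of_nonneg_right hpj (by linarith)
        have h3 : ∑ l ∈ Finset.univ.erase w, -(C * f) ≤
            ∑ l ∈ Finset.univ.erase w, a p l * (u p - u l) :=
          Finset.sum_le_sum fun l _ => hterm l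
        rw [Finset.sum_const, nsmul_eq_mul] at h3
        have h4 : ((Finset.univ.erase w).card : ℝ) ≤ N := by
          exact_mod_cast (Finset.card_le_univ _).trans hcard
        have h5 := mul_le_mul_of_nonneg_right h4 hCf0
        linarith
      have h2 : u p - u w ≤ (1 + N * C) / ε * f := by
        rw [div_mul_eq_mul_div, le_div_iff₀ hε]
        linarith
      linarith
  obtain ⟨C, hC, h⟩ := step N
  refine ⟨C + 1, by positivity, ?_⟩
  intro ι _ hcard a ha ha1 E hE u f hf hu hL i
  obtain ⟨m, -, hm⟩ := Finset.exists_max_image Finset.univ u ⟨i, Finset.mem_univ i⟩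
  rcases h ι hcard a ha ha1 E hE u f hf hu hL m (fun j => hm j (Finset.mem_univ j)) with h | ⟨G, hG, -⟩
  · linarith [hm i (Finset.mem_univ i)]
  · have := G.card_le_univ
    omega

open Classical in
/-- The Green function of the agents of `E`, killed outside `E`. -/
theorem exists_green (N : ℕ) {ε : ℝ} (hε : 0 < ε) :
    ∃ C : ℝ, 0 < C ∧ ∀ (ι : Type) [Fintype ι], Fintype.card ι ≤ N → ∀ (a : ι → ι → ℝ),
      (∀ i j, 0 ≤ a i j) → (∀ i j, a i j ≤ 1) → ∀ (E : Finset ι),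
      (∀ e ∈ E, ∃ s, s ∉ E ∧ Relation.ReflTransGen (fun i j => ε ≤ a i j) e s) →
      ∃ G : ι → ι → ℝ, (∀ v e, e ∈ E → 0 ≤ G v e ∧ G v e ≤ C) ∧
        (∀ v e, v ∉ E → e ∈ E → G v e = 0) ∧
        (∀ v ∈ E, ∀ e ∈ E, v ≠ e → ∑ k, a v k * (G v e - G k e) = 0) ∧
        ∀ k ∈ E, ∀ e ∈ E, G k e * ∑ j, a e j =
          (∑ v ∈ E, G k v * a v e) + if k = e then 1 else 0 := by
  classical
  obtain ⟨C, hC, hmax⟩ := maximum_principle N hε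
  refine ⟨C, hC, ?_⟩
  intro ι _ hcard a ha ha1 E hE
  -- The Laplacian in the rows of `E`, the identity in the other rows. The maximum principle with `f
  -- = 0`, applied to `u` and `-u`, makes it injective.
  let A : Matrix ι ι ℝ := fun v k =>
    (if v = k then (if v ∈ E then ∑ j, a v j else 1) else 0) - if v ∈ E then a v k else 0
  have hAE : ∀ (u : ι → ℝ) (v), v ∈ E → A.mulVec u v = ∑ k, a v k * (u v - u k) := by
    intro u v hv
    simp only [Matrix.mulVec, dotProduct, A, hv, if_true, sub_mul, ite_mul, zero_mul,
      Finset.sum_sub_distrib, Finset.sum_ite_eq, Finset.mem_univ, mul_sub, ← Finset.sum_mul]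
  have hAS : ∀ (u : ι → ℝ) (v), v ∉ E → A.mulVec u v = u v := by
    intro u v hv
    simp [Matrix.mulVec, dotProduct, A, hv]
  have hinj : Function.Injective A.mulVec := by
    refine (injective_iff_map_eq_zero (Matrix.mulVecLin A)).2 fun u hu => ?_
    have hu' : ∀ v, A.mulVec u v = 0 := fun v => congrFun hu v
    have h1 := hmax ι hcard a ha ha1 E hE u 0 le_rfl (fun s hs => by rw [← hAS u s hs, hu'])
      (fun e he => by rw [← hAE u e he, hu'])
    have h2 := hmax ι hcard a ha ha1 E hE (-u) 0 le_rfl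
      (fun s hs => by simp [← hAS u s hs, hu'])
      (fun e he => by
        rw [← hAE (-u) e he, Matrix.mulVec_neg, Pi.neg_apply, hu', neg_zero])
    ext i
    have h3 := h1 i
    have h4 := h2 i
    simp only [mul_zero, Pi.neg_apply] at h3 h4
    simp only [Pi.zero_apply]
    linarith
  have hunit : IsUnit A.det := (Matrix.isUnit_iff_isUnit_det A).1
    (Matrix.mulVec_injective_iff_isUnit.1 hinj)
  -- The right inverse says that the columns are harmonic away from their pole; the left inverse
  -- gives the last clause, which makes elimination exact.
  obtain ⟨B, hcol, hleft⟩ : ∃ B : ι → ι → ℝ,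
      (∀ e v, A.mulVec (fun k => B k e) v = if v = e then 1 else 0) ∧
      ∀ k e, ∑ v, B k v * A v e = if k = e then 1 else 0 := by
    refine ⟨fun v e => A⁻¹ v e, fun e v => ?_, fun k e => ?_⟩
    · have := congrFun (congrFun (Matrix.mul_nonsing_inv A hunit) v) e
      rw [Matrix.mul_apply, Matrix.one_apply] at this
      exact this
    · have := congrFun (congrFun (Matrix.nonsing_inv_mul A hunit) k) e
      rw [Matrix.mul_apply, Matrix.one_apply] at this
      exact this
  have hzero : ∀ v e, v ∉ E → e ∈ E → B v e = 0 := by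
    intro v e hv he
    have := hcol e v
    rw [hAS _ v hv, if_neg (by rintro rfl; exact hv he)] at this
    exact this
  refine ⟨B, ?_, hzero, ?_, ?_⟩
  · intro v e he
    constructor
    · have := hmax ι hcard a ha ha1 E hE (fun k => -B k e) 0 le_rfl
        (fun s hs => by simp [hzero s e hs he])
        (fun w hw => by
          have h1 := hcol e w
          rw [hAE _ w hw] at h1
          have h2 : ∑ k, a w k * (-B w e - -B k e) = -∑ k, a w k * (B w e - B k e) := by
            rw [← Finset.sum_neg_distrib]
            exact Finset.sum_congr rfl fun k _ => by ring
          rw [h2, h1]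
          split_ifs <;> norm_num) v
      linarith
    · have := hmax ι hcard a ha ha1 E hE (fun k => B k e) 1 zero_le_one
        (fun s hs => by simp [hzero s e hs he])
        (fun w hw => by
          rw [← hAE (fun k => B k e) w hw, hcol e w]
          split_ifs <;> norm_num) v
      linarith
  · intro v hv e he hve
    have := hcol e v
    rw [hAE _ v hv, if_neg hve] at this
    exact this
  · intro k hk e he
    have h1 := hleft k e
    have h2 : ∀ v, B k v * A v e = (if v = e then B k e * ∑ j, a e j else 0) -
        if v ∈ E then B k v * a v e else 0 := by
      intro v
      by_cases hve : v = e
      · subst hve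
        simp [A, he, mul_sub]
      · by_cases hv : v ∈ E <;> simp [A, hve, hv]
    simp only [h2, Finset.sum_sub_distrib, Finset.sum_ite_eq', Finset.mem_univ, if_true,
      Finset.sum_ite_mem, Finset.univ_inter] at h1
    linarith

/-- Weights `R i e` with which the agents of `E` have to be added to the agent `i` in order to
eliminate them. The weight is small unless `e` lies in a set around `i` that is left only along
edges of small weight. -/
theorem exists_elimination (N : ℕ) {ε : ℝ} (hε : 0 < ε) :
    ∃ C : ℝ, 0 < C ∧ ∀ (ι : Type) [Fintype ι], Fintype.card ι ≤ N → ∀ (a : ι → ι → ℝ),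
      (∀ i j, 0 ≤ a i j) → (∀ i j, a i j ≤ 1) → ∀ (E : Finset ι),
      (∀ e ∈ E, ∃ s, s ∉ E ∧ Relation.ReflTransGen (fun i j => ε ≤ a i j) e s) →
      ∃ R : ι → ι → ℝ, (∀ i e, 0 ≤ R i e ∧ R i e ≤ C) ∧
        (∀ i e, e ∈ E → R i e * ∑ j, a e j = a i e + ∑ v ∈ E, R i v * a v e) ∧
        ∀ (i : ι) (Q : ι → Prop) (φ : ℝ), i ∉ E → Q i → 0 ≤ φ →
          (∀ v k, Q v → ¬ Q k → a v k ≤ φ) →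
          (∀ v, Q v → Relation.ReflTransGen (fun i j => ε ≤ a i j) v i) →
          ∀ e, ¬ Q e → R i e ≤ C * φ := by
  classical
  obtain ⟨C₁, hC₁, hmax⟩ := maximum_principle N hε
  obtain ⟨C₂, hC₂, hgreen⟩ := exists_green N hε
  refine ⟨N * (C₂ + C₁ * (N * C₂)) + 1, by positivity, ?_⟩
  intro ι _ hcard a ha ha1 E hE
  obtain ⟨G, hG, hG0, hGharm, hGleft⟩ := hgreen ι hcard a ha ha1 E hE
  have hN : ∀ (s : Finset ι) (t : ℝ), 0 ≤ t → s.card * t ≤ N * t := fun s t ht =>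
    mul_le_mul_of_nonneg_right (by exact_mod_cast (Finset.card_le_univ s).trans hcard) ht
  -- Weight the left-inverse identity for `G` by `a i k` and sum over `k ∈ E`.
  refine ⟨fun i e => if e ∈ E then ∑ k ∈ E, a i k * G k e else 0, ?_, ?_, ?_⟩
  · intro i e
    by_cases he : e ∈ E
    · simp only [he, if_true]
      refine ⟨Finset.sum_nonneg fun k _ => mul_nonneg (ha i k) (hG k e he).1, ?_⟩
      have h1 : ∑ k ∈ E, a i k * G k e ≤ ∑ k ∈ E, C₂ := Finset.sum_le_sum fun k _ => by
        have := mul_le_mul (ha1 i k) (hG k e he).2 (hG k e he).1 zero_le_one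
        linarith
      rw [Finset.sum_const, nsmul_eq_mul] at h1
      have h2 := hN E C₂ hC₂.le
      have h3 : 0 ≤ N * (C₁ * (N * C₂)) := by positivity
      linarith [mul_add (N : ℝ) C₂ (C₁ * (N * C₂))]
    · simp only [he, if_false]
      exact ⟨le_rfl, by positivity⟩
  · intro i e he
    have h1 : ∀ v ∈ E, (if v ∈ E then ∑ k ∈ E, a i k * G k v else 0) * a v e
        = ∑ k ∈ E, a i k * (G k v * a v e) := fun v hv => by
      rw [if_pos hv, Finset.sum_mul]
      exact Finset.sum_congr rfl fun k _ => by ring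
    rw [Finset.sum_congr rfl h1, Finset.sum_comm]
    simp only [he, if_true, Finset.sum_mul]
    have h2 : ∀ k ∈ E, a i k * G k e * ∑ j, a e j =
        (if k = e then a i k else 0) + ∑ v ∈ E, a i k * (G k v * a v e) := fun k hk => by
      rw [mul_assoc, hGleft k hk e he, mul_add, Finset.mul_sum, add_comm, mul_ite, mul_one,
        mul_zero]
    rw [Finset.sum_congr rfl h2, Finset.sum_add_distrib, Finset.sum_ite_eq' E e, if_pos he]
  · intro i Q φ hiE hQi hφ hweak hreach e hQe
    by_cases he : e ∈ E
    swap
    · simp only [he, if_false]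
      positivity
    simp only [he, if_true]
    -- Maximum principle inside `Q`, with exit `i`, for the Green function cut off to zero outside
    -- `Q`. Each cut edge has weight at most `φ` and costs at most `C₂ * φ`.
    have hin : ∀ v, Q v → G v e ≤ C₁ * (N * (C₂ * φ)) := by
      intro v hQv
      have key := hmax ι hcard a ha ha1 (E.filter Q)
        (fun w hw => ⟨i, fun h => hiE (Finset.mem_filter.1 h).1,
          hreach w (Finset.mem_filter.1 hw).2⟩)
        (fun w => if Q w then G w e else 0) (N * (C₂ * φ)) (by positivity)
        (fun w hw => by
          by_cases hQw : Q w
          · have hwE : w ∉ E := fun h => hw (Finset.mem_filter.2 ⟨h, hQw⟩)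
            simp [hG0 w e hwE he]
          · simp [hQw])
        (fun w hw => by
          obtain ⟨hwE, hQw⟩ := Finset.mem_filter.1 hw
          have hne : w ≠ e := fun h => hQe (h ▸ hQw)
          have h1 : ∀ k, a w k * ((if Q w then G w e else 0) - if Q k then G k e else 0) ≤
              a w k * (G w e - G k e) + C₂ * φ := fun k => by
            have hp : 0 ≤ C₂ * φ := by positivity
            by_cases hQk : Q k
            · simp only [hQw, hQk, if_true]
              linarith
            · simp only [hQw, hQk, if_true, if_false]
              have h2 := mul_le_mul (hweak w k hQw hQk) (hG k e he).2 (hG k e he).1 hφ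
              linarith [mul_sub (a w k) (G w e) (G k e), mul_sub (a w k) (G w e) 0]
          have h2 := Finset.sum_le_sum fun k (_ : k ∈ Finset.univ) => h1 k
          rw [Finset.sum_add_distrib, hGharm w hwE e he hne, Finset.sum_const, nsmul_eq_mul,
            zero_add] at h2
          exact h2.trans (hN _ _ (by positivity))) v
      simpa [hQv] using key
    have h1 : ∑ k ∈ E, a i k * G k e ≤ ∑ k ∈ E, (C₂ + C₁ * (N * C₂)) * φ :=
      Finset.sum_le_sum fun k _ => by
        have hpos : 0 ≤ C₁ * (N * C₂) * φ := by positivity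
        have hpos' : 0 ≤ C₂ * φ := by positivity
        by_cases hQk : Q k
        · have := mul_le_mul (ha1 i k) (hin k hQk) (hG k e he).1 zero_le_one
          linarith
        · have := mul_le_mul (hweak i k hQi hQk) (hG k e he).2 (hG k e he).1 hφ
          linarith
    rw [Finset.sum_const, nsmul_eq_mul] at h1
    have h2 := hN E ((C₂ + C₁ * (N * C₂)) * φ) (by positivity)
    linarith

/-! ### Roots, representatives and sample ages -/

/-- Some agent is reached from every agent along edges of positive weight. -/
def HasRoot {ι : Type} (a : ι → ι → ℝ) : Prop :=
  ∃ r, ∀ i, Relation.ReflTransGen (fun i j => 0 < a i j) i r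

theorem reflTransGen_subtype {α : Type*} {r : α → α → Prop} {P : α → Prop}
    (hP : ∀ u v, P u → r u v → P v) {u v : α} (huv : Relation.ReflTransGen r u v) (hu : P u) :
    ∃ hv : P v, Relation.ReflTransGen (fun i j : {x // P x} => r i j) ⟨u, hu⟩ ⟨v, hv⟩ := by
  induction huv with
  | refl => exact ⟨hu, .refl⟩
  | @tail v w _ hvw ih =>
    obtain ⟨hv, ih⟩ := ih
    exact ⟨hP v w hv hvw, ih.tail hvw⟩

/-- A smallest set of agents that every agent reaches. -/
theorem exists_representatives {ι : Type} [Fintype ι] (r : ι → ι → Prop)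
    (hr : ∃ i j, i ≠ j ∧ r i j) :
    ∃ S : Finset ι, S.card < Fintype.card ι ∧ (∀ v, ∃ s ∈ S, Relation.ReflTransGen r v s) ∧
      ∀ s ∈ S, ∀ v, Relation.ReflTransGen r s v →
        Relation.ReflTransGen r v s ∧ (v ∈ S → v = s) := by
  classical
  obtain ⟨S, hS, hmin⟩ := Finset.exists_min_image
    (Finset.univ.filter fun S : Finset ι => ∀ v, ∃ s ∈ S, Relation.ReflTransGen r v s)
    Finset.card ⟨Finset.univ, by
      simp only [Finset.mem_filter, Finset.mem_univ, true_and]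
      exact fun v => ⟨v, .refl⟩⟩
  simp only [Finset.mem_filter, Finset.mem_univ, true_and] at hS hmin
  -- By minimality: a representative that reaches another one could be dropped.
  have huniq : ∀ s ∈ S, ∀ s' ∈ S, Relation.ReflTransGen r s s' → s' = s := by
    intro s hs s' hs' hss'
    by_contra hne
    have := hmin (S.erase s) fun v => by
      obtain ⟨w, hw, hvw⟩ := hS v
      by_cases hws : w = s
      · subst hws
        exact ⟨s', Finset.mem_erase.2 ⟨hne, hs'⟩, hvw.trans hss'⟩
      · exact ⟨w, Finset.mem_erase.2 ⟨hws, hw⟩, hvw⟩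
    have := Finset.card_erase_lt_of_mem hs
    omega
  refine ⟨S, ?_, hS, ?_⟩
  · obtain ⟨i, j, hij, hrij⟩ := hr
    have := hmin (Finset.univ.erase i) fun v => by
      by_cases hv : v = i
      · exact ⟨j, by simp [hij.symm], hv ▸ .single hrij⟩
      · exact ⟨v, by simp [hv], .refl⟩
    have := Finset.card_erase_lt_of_mem (Finset.mem_univ i)
    rw [Finset.card_univ] at this
    omega
  · intro s hs v hsv
    refine ⟨?_, fun hv => huniq s hs v hv hsv⟩
    obtain ⟨w, hw, hvw⟩ := hS v
    rwa [huniq s hs w hw (hsv.trans hvw)] at hvw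

theorem le_degree_of_reflTransGen {ι : Type} [Fintype ι] {a : ι → ι → ℝ} {ε : ℝ}
    (ha : ∀ i j, 0 ≤ a i j) {u v : ι}
    (huv : Relation.ReflTransGen (fun i j => ε ≤ a i j) u v) (hne : u ≠ v) :
    ε ≤ ∑ j, a u j := by
  rcases Relation.ReflTransGen.cases_head huv with h | ⟨w, hw, -⟩
  · exact absurd h hne
  · exact hw.trans (Finset.single_le_sum (f := fun j => a u j) (fun j _ => ha u j)
      (Finset.mem_univ w))

/-- Agents of degree at least `ε` have sample age at most `1 / ε`, whatever the global lag bound is.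
-/
theorem lag_of_le_degree {l ε η d : ℝ} (hε : 0 < ε) (hη : 0 ≤ η) (hd : 0 ≤ d) (hl : ε ≤ l)
    (h : l * d ≤ 1 - η) : d ≤ 1 / ε := by
  rw [le_div_iff₀ hε]
  nlinarith

/-- If the signals are close to each other, then the states are close to the signals. -/
theorem SampledFlow.expBdd_sub {ι : Type} [Fintype ι] {η h t₀ : ℝ} {a : ι → ι → ℝ}
    {x z θ : ℝ → ι → ℝ} (fl : SampledFlow η h t₀ a x z 0 θ) (hη : 0 ≤ η) (hh : 0 ≤ h)
    {c b D : ℝ} (hc : 0 ≤ c) (hD : 0 ≤ D) (herr : ∀ i, ExpBdd c b (fun t => |z t i - x (θ t i) i|))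
    (hz : ∀ i j, ExpBdd c D (fun t => |z t i - z t j|)) (i : ι) :
    ExpBdd c (b + D) (fun t => |x t i - z t i|) := by
  obtain ⟨K, hK, hev⟩ := ExpBdd.exists_forall_window (ι := ι × ι)
    (F := fun p t => |z t p.1 - z t p.2|) hc (fun p => hz p.1 p.2) h
  have h1 : ExpBdd c D (fun t => |x t i - x (θ t i) i|) := by
    refine ⟨K, hK, ?_⟩
    filter_upwards [hev, eventually_ge_atTop (t₀ + h)] with t ht ht₀
    set d := D + K * Real.exp (-c * t) with hd
    have hd0 : 0 ≤ d := by positivity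
    have ht₀' : t₀ ≤ t := by linarith
    have hlag := fl.lag t ht₀' i
    have hle := fl.le_time t ht₀' i
    have hrate : ∀ s ∈ Ico (θ t i) t,
        |∑ j, a i j * (z s j - z s i) + (0 : ℝ → ι → ℝ) s i| ≤ (∑ j, a i j) * d := by
      intro s hs
      simp only [Pi.zero_apply, add_zero, Finset.sum_mul]
      refine (Finset.abs_sum_le_sum_abs _ _).trans (Finset.sum_le_sum fun j _ => ?_)
      rw [abs_mul, abs_of_nonneg (fl.nonneg i j)]
      exact mul_le_mul_of_nonneg_left (ht s (by linarith [hs.1]) (j, i)) (fl.nonneg i j)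
    have hcont : ContinuousOn (fun s => x s i) (Icc (θ t i) t) :=
      (fl.cont i).mono fun s hs => mem_Ici.2 (by linarith [hs.1])
    have hder : ∀ s ∈ Ico (θ t i) t, HasDerivWithinAt (fun s => x s i)
        (∑ j, a i j * (z s j - z s i) + (0 : ℝ → ι → ℝ) s i) (Ici s) s :=
      fun s hs => fl.deriv s (by linarith [hs.1]) i
    have hup := le_add_mul_of_rightDeriv_le hcont hder
      (fun s hs => (abs_le.1 (hrate s hs)).2) ⟨hle, le_rfl⟩
    have hlo := add_mul_le_of_le_rightDeriv hcont hder
      (fun s hs => (abs_le.1 (hrate s hs)).1) ⟨hle, le_rfl⟩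
    have hg := mul_le_mul_of_nonneg_right (fl.gain t ht₀' i) hd0
    have : (1 - η) * d ≤ d := by nlinarith
    rw [abs_le]
    constructor <;> linarith [mul_right_comm (∑ j, a i j) d (t - θ t i)]
  refine (h1.add (herr i)).mono (by linarith) (Eventually.of_forall fun t => ?_)
  have := abs_sub_le (x t i) (x (θ t i) i) (z t i)
  rwa [abs_sub_comm (x (θ t i) i) (z t i)] at this

/-! ### Exact elimination of agents -/

section Reduction

variable {ι : Type} [Fintype ι] [DecidableEq ι] {a R : ι → ι → ℝ} {S : Finset ι}

/-- The factor by which the weight of agent `i` grows when the agents outside `S` are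
eliminated. -/
def mass (R : ι → ι → ℝ) (S : Finset ι) (i : ι) : ℝ := 1 + ∑ e ∈ Sᶜ, R i e

/-- The weights on `S` after the elimination of the other agents. -/
def reducedWeight (a R : ι → ι → ℝ) (S : Finset ι) (i k : S) : ℝ :=
  (a i k + ∑ v ∈ Sᶜ, R i v * a v k) / mass R S i

/-- The states on `S` after the elimination of the other agents. -/
def reducedState (R : ι → ι → ℝ) (S : Finset ι) (x : ℝ → ι → ℝ) (t : ℝ) (i : S) : ℝ :=
  (x t i + ∑ e ∈ Sᶜ, R i e * x t e) / mass R S i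

theorem one_le_mass (hR : ∀ i e, 0 ≤ R i e) (i : ι) : 1 ≤ mass R S i :=
  le_add_of_nonneg_right (Finset.sum_nonneg fun e _ => hR i e)

theorem abs_reducedState_sub_le (hR : ∀ i e, 0 ≤ R i e) (x : ℝ → ι → ℝ) (t y : ℝ) (i : S) :
    |reducedState R S x t i - y| ≤ |x t i - y| + ∑ e ∈ Sᶜ, R i e * |x t e - y| := by
  have hm := one_le_mass (S := S) hR i
  have hm0 : 0 < mass R S i := by linarith
  have h1 : reducedState R S x t i - y =
      ((x t i - y) + ∑ e ∈ Sᶜ, R i e * (x t e - y)) / mass R S i := by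
    rw [reducedState, eq_div_iff hm0.ne', sub_mul, div_mul_cancel₀ _ hm0.ne']
    simp only [mass, mul_sub, Finset.sum_sub_distrib, ← Finset.sum_mul]
    ring
  rw [h1, abs_div, abs_of_pos hm0, div_le_iff₀ hm0]
  have h2 : |x t i - y + ∑ e ∈ Sᶜ, R i e * (x t e - y)| ≤
      |x t i - y| + ∑ e ∈ Sᶜ, R i e * |x t e - y| := by
    refine (abs_add_le _ _).trans (add_le_add_right ?_ _)
    refine (Finset.abs_sum_le_sum_abs _ _).trans (Finset.sum_le_sum fun e _ => ?_)
    rw [abs_mul, abs_of_nonneg (hR i e)]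
  refine h2.trans (le_mul_of_one_le_right ?_ hm)
  exact add_nonneg (abs_nonneg _) (Finset.sum_nonneg fun e _ => mul_nonneg (hR _ _) (abs_nonneg _))

/-- The equation for `R` says exactly that the coefficient of each eliminated `ξ e` vanishes. -/
theorem elimination_identity
    (hRa : ∀ i e, e ∈ Sᶜ → R i e * ∑ j, a e j = a i e + ∑ v ∈ Sᶜ, R i v * a v e)
    (i : ι) (ξ : ι → ℝ) :
    ∑ k, a i k * ξ k + ∑ e ∈ Sᶜ, R i e * ∑ k, a e k * (ξ k - ξ e) =
      ∑ k ∈ S, (a i k + ∑ v ∈ Sᶜ, R i v * a v k) * ξ k := by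
  have h1 : ∑ e ∈ Sᶜ, R i e * ∑ k, a e k * (ξ k - ξ e) =
      ∑ k, (∑ v ∈ Sᶜ, R i v * a v k) * ξ k - ∑ e ∈ Sᶜ, (R i e * ∑ k, a e k) * ξ e := by
    simp only [Finset.sum_mul]
    rw [Finset.sum_comm, ← Finset.sum_sub_distrib]
    refine Finset.sum_congr rfl fun e _ => ?_
    simp only [Finset.mul_sum, Finset.sum_mul, ← Finset.sum_sub_distrib]
    exact Finset.sum_congr rfl fun k _ => by ring
  have h2 : ∑ e ∈ Sᶜ, (R i e * ∑ k, a e k) * ξ e =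
      ∑ k ∈ Sᶜ, (a i k + ∑ v ∈ Sᶜ, R i v * a v k) * ξ k :=
    Finset.sum_congr rfl fun e he => by rw [hRa i e he]
  have h3 := Finset.sum_add_sum_compl S fun k => (a i k + ∑ v ∈ Sᶜ, R i v * a v k) * ξ k
  have h4 : ∑ k, (a i k + ∑ v ∈ Sᶜ, R i v * a v k) * ξ k =
      ∑ k, a i k * ξ k + ∑ k, (∑ v ∈ Sᶜ, R i v * a v k) * ξ k := by
    simp only [add_mul, Finset.sum_add_distrib]
  linarith

theorem sum_reducedWeight_mul
    (hRa : ∀ i e, e ∈ Sᶜ → R i e * ∑ j, a e j = a i e + ∑ v ∈ Sᶜ, R i v * a v e)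
    (i : S) (ξ : ι → ℝ) :
    ∑ k : S, reducedWeight a R S i k * ξ k =
      (∑ k, a i k * ξ k + ∑ e ∈ Sᶜ, R i e * ∑ k, a e k * (ξ k - ξ e)) / mass R S i := by
  rw [elimination_identity hRa, ← Finset.sum_coe_sort S, Finset.sum_div]
  exact Finset.sum_congr rfl fun k _ => by rw [reducedWeight]; ring

/-- Elimination divides the in-degree by the mass, which is at least 1, so the old sampling times
still satisfy the gain condition. -/
theorem sum_reducedWeight
    (hRa : ∀ i e, e ∈ Sᶜ → R i e * ∑ j, a e j = a i e + ∑ v ∈ Sᶜ, R i v * a v e) (i : S) :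
    ∑ k : S, reducedWeight a R S i k = (∑ k, a i k) / mass R S i := by
  simpa using sum_reducedWeight_mul hRa i fun _ => 1

theorem reducedWeight_nonneg (ha : ∀ i j, 0 ≤ a i j) (hR : ∀ i e, 0 ≤ R i e) (i k : S) :
    0 ≤ reducedWeight a R S i k :=
  div_nonneg (add_nonneg (ha _ _) (Finset.sum_nonneg fun _ _ => mul_nonneg (hR _ _) (ha _ _)))
    (zero_le_one.trans (one_le_mass hR i))

theorem sum_reducedWeight_le (ha : ∀ i j, 0 ≤ a i j) (hR : ∀ i e, 0 ≤ R i e)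
    (hRa : ∀ i e, e ∈ Sᶜ → R i e * ∑ j, a e j = a i e + ∑ v ∈ Sᶜ, R i v * a v e) (i : S) :
    ∑ k : S, reducedWeight a R S i k ≤ ∑ k, a i k := by
  rw [sum_reducedWeight hRa]
  exact div_le_self (Finset.sum_nonneg fun k _ => ha _ _) (one_le_mass hR i)

/-- After the elimination of the agents outside `S`, the others form a flow with the same signals.
For the agents with `P i`, the sampling time is replaced by the current time. -/
theorem SampledFlow.reduce {η h t₀ : ℝ} {x z θ : ℝ → ι → ℝ}
    (fl : SampledFlow η h t₀ a x z 0 θ) (hη : η ≤ 1) (hh : 0 ≤ h) (hR : ∀ i e, 0 ≤ R i e)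
    (hRa : ∀ i e, e ∈ Sᶜ → R i e * ∑ j, a e j = a i e + ∑ v ∈ Sᶜ, R i v * a v e)
    (P : S → Prop) [DecidablePred P] :
    SampledFlow η h t₀ (reducedWeight a R S) (reducedState R S x) (fun t i => z t i) 0
      (fun t i => if P i then t else θ t i) where
  nonneg := reducedWeight_nonneg fl.nonneg hR
  cont i := by
    refine ContinuousOn.div_const ((fl.cont i).add (continuousOn_finsetSum _ fun e _ =>
      continuousOn_const.mul (fl.cont e))) _
  deriv t ht i := by
    have h1 := ((fl.deriv t ht i).add (HasDerivWithinAt.fun_sum (u := Sᶜ) fun e _ =>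
      (fl.deriv t ht e).const_mul (R i e))).div_const (mass R S i)
    have h2 := sum_reducedWeight_mul hRa i fun k => z t k - z t i
    simp only [sub_sub_sub_cancel_right] at h2
    simp only [Pi.zero_apply, add_zero] at h1 ⊢
    rw [h2]
    exact h1
  le_time t ht i := by
    split_ifs
    exacts [le_rfl, fl.le_time t ht i]
  lag t ht i := by
    split_ifs
    exacts [by linarith, fl.lag t ht i]
  hold t ht i s hs hst := by
    by_cases hP : P i
    · simp only [hP, if_true] at hs ⊢
      linarith
    · simp only [hP, if_false] at hs ⊢
      exact fl.hold t ht i s hs hst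
  gain t ht i := by
    by_cases hP : P i
    · simp only [hP, if_true]
      linarith
    · simp only [hP, if_false]
      exact (mul_le_mul_of_nonneg_right (sum_reducedWeight_le fl.nonneg hR hRa i)
        (by linarith [fl.le_time t ht i])).trans (fl.gain t ht i)

/-- A path that runs through eliminated agents is shortcut. Along it, the last visited agent `i'` of
`S` keeps `R i' v > 0` at the current eliminated agent `v`, so re-entering `S` is a single reduced
edge from `i'`. -/
theorem HasRoot.reduce (ha : ∀ i j, 0 ≤ a i j) (hR : ∀ i e, 0 ≤ R i e)
    (hRa : ∀ i e, e ∈ Sᶜ → R i e * ∑ j, a e j = a i e + ∑ v ∈ Sᶜ, R i v * a v e)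
    (hroot : HasRoot a)
    (hS : ∀ v, ∃ s ∈ S, Relation.ReflTransGen (fun i j => 0 < a i j) v s) :
    HasRoot (reducedWeight a R S) := by
  obtain ⟨r, hr⟩ := hroot
  obtain ⟨s, hs, hrs⟩ := hS r
  have hpos : ∀ i v, v ∈ Sᶜ → 0 < a i v + ∑ w ∈ Sᶜ, R i w * a w v → 0 < R i v := by
    intro i v hv h
    rw [← hRa i v hv] at h
    exact pos_of_mul_pos_left h (Finset.sum_nonneg fun j _ => ha v j)
  have hsum : ∀ i v w, w ∈ Sᶜ → 0 < R i w → 0 < a w v →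
      0 < a i v + ∑ w ∈ Sᶜ, R i w * a w v := fun i v w hw h1 h2 =>
    add_pos_of_nonneg_of_pos (ha i v) ((mul_pos h1 h2).trans_le
      (Finset.single_le_sum (f := fun w => R i w * a w v)
        (fun u _ => mul_nonneg (hR i u) (ha u v)) hw))
  have hdir : ∀ i v, 0 < a i v → 0 < a i v + ∑ w ∈ Sᶜ, R i w * a w v := fun i v h =>
    add_pos_of_pos_of_nonneg h (Finset.sum_nonneg fun w _ => mul_nonneg (hR i w) (ha w v))
  have hmass : ∀ i, 0 < mass R S i := fun i => zero_lt_one.trans_le (one_le_mass hR i)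
  refine ⟨⟨s, hs⟩, fun i => ?_⟩
  have key : ∀ v, Relation.ReflTransGen (fun i j => 0 < a i j) i v →
      (∀ hv : v ∈ S, Relation.ReflTransGen (fun i j => 0 < reducedWeight a R S i j) i ⟨v, hv⟩) ∧
      (v ∈ Sᶜ → ∃ i' : S, Relation.ReflTransGen (fun i j => 0 < reducedWeight a R S i j) i i' ∧
        0 < R i' v) := by
    intro v hv
    induction hv with
    | refl => exact ⟨fun _ => .refl, fun h => absurd i.2 (Finset.mem_compl.1 h)⟩
    | @tail v w _ hvw ih =>
      by_cases hvS : v ∈ S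
      · have hiv := ih.1 hvS
        exact ⟨fun hw => hiv.tail (div_pos (hdir v w hvw) (hmass v)),
          fun hw => ⟨⟨v, hvS⟩, hiv, hpos v w hw (hdir v w hvw)⟩⟩
      · obtain ⟨i', hi', hRi'⟩ := ih.2 (Finset.mem_compl.2 hvS)
        have hsm := hsum i' w v (Finset.mem_compl.2 hvS) hRi' hvw
        exact ⟨fun hw => hi'.tail (div_pos hsm (hmass i')),
          fun hw => ⟨i', hi', hpos i' w hw hsm⟩⟩
  exact (key s ((hr i).trans hrs)).1 hs

end Reduction

/-! ### Uniform bounds; subflows and lumping -/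

/-- A bound, uniform up to exponentially decaying terms, on the differences of the signals in all
flows with the weights `a`. -/
def UniformBound {ι : Type} [Fintype ι] (η C : ℝ) (a : ι → ι → ℝ) : Prop :=
  ∀ h, 0 ≤ h → ∃ c₀ : ℝ, 0 < c₀ ∧ ∀ c, 0 < c → c ≤ c₀ → ∀ b, 0 ≤ b →
    ∀ (t₀ : ℝ) (x z θ : ℝ → ι → ℝ), SampledFlow η h t₀ a x z 0 θ →
    (∀ i, ExpBdd c b (fun t => |z t i - x (θ t i) i|)) →
    ∀ i j, ExpBdd c (C * b) (fun t => |z t i - z t j|)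

section Restriction

variable {ι : Type} [Fintype ι] {η h t₀ : ℝ} {a : ι → ι → ℝ} {x z θ : ℝ → ι → ℝ}

open Classical in
/-- The restriction of a flow to the agents with `P`, the other agents being external inputs. -/
theorem SampledFlow.restrict (fl : SampledFlow η h t₀ a x z 0 θ) (P : ι → Prop) {h' : ℝ}
    (hlag : ∀ t, t₀ ≤ t → ∀ i, P i → t - h' ≤ θ t i) :
    SampledFlow η h' t₀ (fun i j : {i // P i} => a i j) (fun t i => x t i) (fun t i => z t i)
      (fun t i => ∑ k : {k // ¬ P k}, a i k * (z t k - z t i)) (fun t i => θ t i) where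
  nonneg i j := fl.nonneg i j
  cont i := fl.cont i
  deriv t ht i := by
    have h1 := fl.deriv t ht i
    have h2 := Fintype.sum_subtype_add_sum_subtype P fun k => a i k * (z t k - z t i)
    simp only [Pi.zero_apply, add_zero] at h1
    rw [h2]
    exact h1
  le_time t ht i := fl.le_time t ht i
  lag t ht i := hlag t ht i i.2
  hold t ht i := fl.hold t ht i
  gain t ht i := by
    have h2 := Fintype.sum_subtype_add_sum_subtype P fun k => a i k
    have h3 : 0 ≤ ∑ k : {k // ¬ P k}, a i k := Finset.sum_nonneg fun k _ => fl.nonneg _ _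
    exact (mul_le_mul_of_nonneg_right (by linarith)
      (by linarith [fl.le_time t ht i])).trans (fl.gain t ht i)

/-- The flow on the agents outside `S`, with the agents of `S` lumped into one root with state
`m`. -/
theorem SampledFlow.lump [DecidableEq ι] (fl : SampledFlow η h t₀ a x z 0 θ) (S : Finset ι)
    {h' : ℝ} (hη : η ≤ 1) (hh' : 0 ≤ h') (hlag : ∀ t, t₀ ≤ t → ∀ i ∈ Sᶜ, t - h' ≤ θ t i)
    {m m' : ℝ → ℝ} (hm : ContinuousOn m (Ici t₀))
    (hm' : ∀ t, t₀ ≤ t → HasDerivWithinAt m (m' t) (Ici t) t) :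
    SampledFlow (ι := Option ↥(Sᶜ)) η h' t₀
      (fun o o' => o.elim 0 fun e => o'.elim (∑ s ∈ S, a e s) fun e' => a e e')
      (fun t o => o.elim (m t) fun e => x t e) (fun t o => o.elim (m t) fun e => z t e)
      (fun t o => o.elim (m' t) fun e => ∑ s ∈ S, a e s * (z t s - m t))
      (fun t o => o.elim t fun e => θ t e) where
  nonneg o o' := by
    rcases o with _ | e
    · exact le_rfl
    · rcases o' with _ | e'
      · exact Finset.sum_nonneg fun s _ => fl.nonneg _ _
      · exact fl.nonneg _ _
  cont o := by
    rcases o with _ | e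
    · exact hm
    · exact fl.cont e
  deriv t ht o := by
    rcases o with _ | e
    · simpa using hm' t ht
    · have h1 := fl.deriv t ht e
      refine h1.congr_deriv ?_
      simp only [Pi.zero_apply, add_zero, Fintype.sum_option, Option.elim_none, Option.elim_some]
      rw [Finset.sum_coe_sort (Sᶜ) (fun k => a e k * (z t k - z t e)),
        ← Finset.sum_add_sum_compl S, Finset.sum_mul, add_right_comm, ← Finset.sum_add_distrib]
      congr 1
      exact Finset.sum_congr rfl fun s _ => by ring
  le_time t ht o := by
    rcases o with _ | e
    · exact le_rfl
    · exact fl.le_time t ht e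
  lag t ht o := by
    rcases o with _ | e
    · simpa using hh'
    · exact hlag t ht e e.2
  hold t ht o s hs hst := by
    rcases o with _ | e
    · exact le_antisymm hst hs
    · exact fl.hold t ht e s hs hst
  gain t ht o := by
    rcases o with _ | e
    · simpa using hη
    · have h1 := fl.gain t ht e
      simp only [Fintype.sum_option, Option.elim_none, Option.elim_some]
      rwa [Finset.sum_coe_sort (Sᶜ) (fun k => a e k), Finset.sum_add_sum_compl S]

end Restriction

/-! ### Separation of scales -/

set_option maxHeartbeats 1000000 in
/-- If the weights are either at least `ε` or at most `φ`, then a bound `D` on the differences of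
the signals improves to a multiple of `b + φ * D`. -/
theorem exists_improvement {η C₀ ε : ℝ} (hη : 0 < η) (hη1 : η ≤ 1) (hC₀ : 0 < C₀) (hε : 0 < ε)
    (n : ℕ)
    (ih : ∀ (ι : Type) [Fintype ι], Fintype.card ι < n → ∀ a : ι → ι → ℝ, (∀ i j, 0 ≤ a i j) →
      HasRoot a → UniformBound η C₀ a) :
    ∃ C : ℝ, 0 < C ∧ ∀ φ, 0 ≤ φ → φ ≤ 1 → ∀ (ι : Type) [Fintype ι], Fintype.card ι = n →
      ∀ a : ι → ι → ℝ, (∀ i j, 0 ≤ a i j) → (∀ i j, a i j ≤ 1) → HasRoot a →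
      (∃ i j, i ≠ j ∧ ε ≤ a i j) → (∀ i j, i ≠ j → ε ≤ a i j ∨ a i j ≤ φ) →
      ∀ h, 0 ≤ h → ∃ c₀ : ℝ, 0 < c₀ ∧ ∀ c, 0 < c → c ≤ c₀ → ∀ b, 0 ≤ b → ∀ D, 0 ≤ D →
      ∀ (t₀ : ℝ) (x z θ : ℝ → ι → ℝ), SampledFlow η h t₀ a x z 0 θ →
      (∀ i, ExpBdd c b (fun t => |z t i - x (θ t i) i|)) →
      (∀ i j, ExpBdd c D (fun t => |z t i - z t j|)) →
      ∀ i j, ExpBdd c (C * (b + φ * D)) (fun t => |z t i - z t j|) := by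
  classical
  have hεh : (0 : ℝ) ≤ 1 / ε := by positivity
  -- The contraction theorem is only used for agents of degree at least `ε` (and a lumped root), so
  -- the lag `1 / ε` is enough and `C_F` does not involve `h`.
  obtain ⟨C_F, c_F, hC_F, hc_F, hF⟩ := SampledFlow.expBdd n hη hε hεh
    (show (0 : ℝ) < n + 1 by positivity)
  obtain ⟨C_R, hC_R, hElim⟩ := exists_elimination n hε
  set C₁ : ℝ := 1 + C_F * (1 + n) + n * (C_R * (C_F * (1 + n)) + C_R * 4) with hC₁
  have hC₁0 : 0 < C₁ := by positivity
  refine ⟨2 * (C_F * (1 + n * (n * (C₀ * C₁)) + n * (2 * (C₀ * C₁) + C₁)) +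
    (2 * (C₀ * C₁) + C₁)), by positivity, ?_⟩
  intro φ hφ hφ1 ι _ hcard a ha ha1 hroot hedge hsep h hh
  obtain ⟨S, hScard, hreach, hS⟩ := exists_representatives (fun i j => ε ≤ a i j) hedge
  have hcompl : ∀ e ∈ Sᶜ, ∃ s, s ∉ Sᶜ ∧ Relation.ReflTransGen (fun i j => ε ≤ a i j) e s :=
    fun e _ => by
      obtain ⟨s, hs, hes⟩ := hreach e
      exact ⟨s, by simpa using hs, hes⟩
  obtain ⟨R, hR, hRa, hRsmall⟩ := hElim ι hcard.le a ha ha1 Sᶜ hcompl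
  have hR0 : ∀ i e, 0 ≤ R i e := fun i e => (hR i e).1
  have hdeg : ∀ i, ∑ j, a i j ≤ n := fun i => by
    have := Finset.sum_le_sum fun j (_ : j ∈ Finset.univ) => ha1 i j
    simpa [hcard] using this
  have hredroot : HasRoot (reducedWeight a R S) := hroot.reduce ha hR0 hRa fun v => by
    obtain ⟨s, hs, hvs⟩ := hreach v
    exact ⟨s, hs, hvs.lift id fun i j hij => hε.trans_le hij⟩
  obtain ⟨c_S, hc_S, hih⟩ := ih S (by rw [Fintype.card_coe]; omega) (reducedWeight a R S)
    (reducedWeight_nonneg ha hR0) hredroot h hh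
  refine ⟨min c_F c_S, by positivity, ?_⟩
  intro c hc hcc b hb D hD t₀ x z θ fl herr hz
  have hcF : c ≤ c_F := hcc.trans (min_le_left _ _)
  have hcS : c ≤ c_S := hcc.trans (min_le_right _ _)
  set B := b + φ * D with hB
  have hφD : 0 ≤ φ * D := by positivity
  have hB0 : 0 ≤ B := by positivity
  have hbB : b ≤ B := by linarith
  have hxz : ∀ i, ExpBdd c (b + D) (fun t => |x t i - z t i|) :=
    fl.expBdd_sub hη.le hh hc.le hD herr hz
  have hlagε : ∀ i, ε ≤ ∑ j, a i j → ∀ t, t₀ ≤ t → t - 1 / ε ≤ θ t i := fun i hi t ht => by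
    have := lag_of_le_degree hε hη.le (by linarith [fl.le_time t ht i]) hi (fl.gain t ht i)
    linarith
  have hweak : ∀ s v k, Relation.ReflTransGen (fun i j => ε ≤ a i j) s v →
      ¬ Relation.ReflTransGen (fun i j => ε ≤ a i j) s k → a v k ≤ φ := by
    intro s v k hsv hsk
    rcases hsep v k (by rintro rfl; exact hsk hsv) with hvk | hvk
    · exact absurd (hsv.tail hvk) hsk
    · exact hvk
  -- The class of `s` is strongly connected by strong edges and left only by weak ones, so its
  -- external input is at most `n * φ * D` up to decay.
  have hclass : ∀ s ∈ S, (∃ v, v ≠ s ∧ Relation.ReflTransGen (fun i j => ε ≤ a i j) s v) →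
      ∀ v w, Relation.ReflTransGen (fun i j => ε ≤ a i j) s v →
        Relation.ReflTransGen (fun i j => ε ≤ a i j) s w →
        ExpBdd c (C_F * ((1 + n) * B)) (fun t => |x t v - z t w|) := by
    intro s hs hnt v w hv hw
    set P : ι → Prop := fun v => Relation.ReflTransGen (fun i j => ε ≤ a i j) s v with hP
    have hdegP : ∀ v, P v → ε ≤ ∑ j, a v j := fun v hv => by
      by_cases hvs : v = s
      · subst hvs
        obtain ⟨u, hu, hvu⟩ := hnt
        exact le_degree_of_reflTransGen ha hvu hu.symm
      · exact le_degree_of_reflTransGen ha (hS s hs v hv).1 hvs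
    have flP := fl.restrict P fun t ht i hi => hlagε i (hdegP i hi) t ht
    have hcardP : Fintype.card {i // P i} ≤ n := hcard ▸ Fintype.card_subtype_le P
    have hcardP' : (Fintype.card {i // ¬ P i} : ℝ) ≤ n := by
      exact_mod_cast hcard ▸ Fintype.card_subtype_le (fun i => ¬ P i)
    refine hF _ hcardP t₀ _ _ _ _ _ flP ?_ ⟨s, .refl⟩ ?_ c hc hcF ((1 + n) * B) (by positivity)
      ?_ ?_ ⟨v, hv⟩ ⟨w, hw⟩
    · intro i
      have h2 := Fintype.sum_subtype_add_sum_subtype P fun k => a i k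
      have h3 : 0 ≤ ∑ k : {k // ¬ P k}, a i k := Finset.sum_nonneg fun k _ => ha _ _
      linarith [hdeg i]
    · rintro ⟨i, hi⟩
      exact (reflTransGen_subtype (P := P) (fun u v hu huv => hu.tail huv) (hS s hs i hi).1 hi).2
    · intro i
      refine (herr i).mono_const ?_
      have : 0 ≤ n * B := by positivity
      linarith
    · intro i
      have h1 : ExpBdd c (Fintype.card {k // ¬ P k} * (φ * D))
          (fun t => ∑ k : {k // ¬ P k}, φ * |z t k - z t i|) :=
        ExpBdd.sum_univ_const fun k => (hz k i).const_mul hφ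
      refine h1.mono ?_ (Eventually.of_forall fun t => ?_)
      · have h2 := mul_le_mul_of_nonneg_right hcardP' hφD
        have h3 : n * (φ * D) ≤ n * B := by gcongr; linarith
        linarith
      · refine (Finset.abs_sum_le_sum_abs _ _).trans (Finset.sum_le_sum fun k _ => ?_)
        rw [abs_mul, abs_of_nonneg (ha _ _)]
        exact mul_le_mul_of_nonneg_right (hweak s i k i.2 k.2) (abs_nonneg _)
  -- In a class of several agents all degrees are at least `ε`, and states stay close to the signal
  -- of `s` at the current time, which may serve as sampling time. A one-agent class may be
  -- arbitrarily slow and must keep its own sampling time; but then every eliminated agent lies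
  -- outside the class and has weight of order `φ`.
  set nontrivial : S → Prop := fun s =>
    ∃ v, v ≠ s.1 ∧ Relation.ReflTransGen (fun i j => ε ≤ a i j) s.1 v with hnontrivial
  have flS := fl.reduce (S := S) hη1 hh hR0 hRa nontrivial
  have hRfar : ∀ s ∈ S, ∀ e, ¬ Relation.ReflTransGen (fun i j => ε ≤ a i j) s e →
      R s e ≤ C_R * φ := fun s hs e he =>
    hRsmall s (fun v => Relation.ReflTransGen (fun i j => ε ≤ a i j) s v) φ (by simpa using hs)
      .refl hφ (hweak s) (fun v hv => (hS s hs v hv).1) e he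
  have hcardE : ((Sᶜ.card : ℕ) : ℝ) ≤ n := by
    exact_mod_cast hcard ▸ Finset.card_le_univ Sᶜ
  have hsumE : ∀ q : ℝ, 0 ≤ q → ∑ e ∈ Sᶜ, q ≤ n * q := fun q hq => by
    rw [Finset.sum_const, nsmul_eq_mul]
    exact mul_le_mul_of_nonneg_right hcardE hq
  have herrS : ∀ s : S, ExpBdd c (C₁ * B)
      (fun t => |z t s - reducedState R S x (if nontrivial s then t else θ t s) s|) := by
    intro s
    have hq : 0 ≤ (C_R * (C_F * (1 + n)) + C_R * 4) * B := by positivity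
    have hCRF : 0 ≤ C_R * (C_F * (1 + n)) * B := by positivity
    have hCR4 : 0 ≤ C_R * 4 * B := by positivity
    have hCF : 0 ≤ C_F * (1 + n) * B := by positivity
    by_cases hnt : nontrivial s
    · have hterm : ∀ e ∈ Sᶜ, ExpBdd c ((C_R * (C_F * (1 + n)) + C_R * 4) * B)
          (fun t => R s e * |x t e - z t s|) := by
        intro e _
        by_cases hse : Relation.ReflTransGen (fun i j => ε ≤ a i j) s.1 e
        · refine ((hclass s s.2 hnt e s hse .refl).const_mul hC_R.le).mono (by linarith)
            (Eventually.of_forall fun t => ?_)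
          exact mul_le_mul_of_nonneg_right (hR s e).2 (abs_nonneg _)
        · refine (((hxz e).add (hz e s)).const_mul (show 0 ≤ C_R * φ by positivity)).mono ?_
            (Eventually.of_forall fun t => ?_)
          · have h1 : φ * (b + D + D) ≤ 4 * B := by nlinarith
            have h2 := mul_le_mul_of_nonneg_left h1 hC_R.le
            linarith
          · exact mul_le_mul (hRfar s s.2 e hse) (abs_sub_le _ _ _) (abs_nonneg _) (by positivity)
      refine ((hclass s s.2 hnt s s .refl .refl).add (ExpBdd.sum Sᶜ hterm)).mono ?_
        (Eventually.of_forall fun t => ?_)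
      · have := hsumE _ hq
        rw [hC₁]
        linarith
      · simp only [hnt, if_true]
        rw [abs_sub_comm]
        exact abs_reducedState_sub_le hR0 x t (z t s) s
    · have hterm : ∀ e ∈ Sᶜ, ExpBdd c ((C_R * (C_F * (1 + n)) + C_R * 4) * B)
          (fun t => R s e * |x (θ t s) e - z t s|) := by
        intro e he
        have hse : ¬ Relation.ReflTransGen (fun i j => ε ≤ a i j) s.1 e := fun hse =>
          hnt ⟨e, by rintro rfl; exact (Finset.mem_compl.1 he) s.2, hse⟩
        have hxx : ExpBdd c (b + D + D + (b + D)) (fun t => |x t e - x t s|) := by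
          refine (((hxz e).add (hz e s)).add (hxz s)).mono le_rfl (Eventually.of_forall fun t => ?_)
          have h1 := abs_sub_le (x t e) (z t e) (x t s)
          have h2 := abs_sub_le (z t e) (z t s) (x t s)
          rw [abs_sub_comm (z t s) (x t s)] at h2
          linarith
        have hxx' := hxx.comp_lag hc.le (σ := fun t => θ t s) (h := h) (by
          filter_upwards [eventually_ge_atTop t₀] with t ht using fl.lag t ht s)
        refine ((hxx'.add (herr s)).const_mul (show 0 ≤ C_R * φ by positivity)).mono ?_
          (Eventually.of_forall fun t => ?_)
        · have h1 : φ * (b + D + D + (b + D) + b) ≤ 4 * B := by nlinarith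
          have h2 := mul_le_mul_of_nonneg_left h1 hC_R.le
          linarith
        · refine mul_le_mul (hRfar s s.2 e hse) ?_ (abs_nonneg _) (by positivity)
          rw [abs_sub_comm (z t s)]
          exact abs_sub_le _ _ _
      refine ((herr s).add (ExpBdd.sum Sᶜ hterm)).mono ?_ (Eventually.of_forall fun t => ?_)
      · have := hsumE _ hq
        rw [hC₁]
        linarith
      · simp only [hnt, if_false]
        rw [abs_sub_comm, abs_sub_comm (z t s)]
        exact abs_reducedState_sub_le hR0 x (θ t s) (z t s) s
  set b₁ := C₁ * B with hb₁
  have hb₁0 : 0 ≤ b₁ := by positivity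
  have hzS := hih c hc hcS b₁ hb₁0 t₀ _ _ _ flS herrS
  set b₂ := C₀ * b₁ with hb₂
  have hb₂0 : 0 ≤ b₂ := by positivity
  have hXz := flS.expBdd_sub hη.le hh hc.le hb₂0 herrS hzS
  obtain ⟨i₀, -⟩ := hedge
  obtain ⟨s₀, hs₀, -⟩ := hreach i₀
  -- The lumped root moves like one reduced state, whose speed is controlled by the signal
  -- differences on `S`.
  set m : ℝ → ℝ := fun t => reducedState R S x t ⟨s₀, hs₀⟩ with hm
  have hSm : ∀ s : S, ExpBdd c (2 * b₂ + b₁) (fun t => |z t s - m t|) := fun s => by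
    refine ((hzS s ⟨s₀, hs₀⟩).add (hXz ⟨s₀, hs₀⟩)).mono (by linarith)
      (Eventually.of_forall fun t => ?_)
    have := abs_sub_le (z t s) (z t s₀) (m t)
    rwa [abs_sub_comm (z t s₀) (m t)] at this
  have hdegE : ∀ e ∈ Sᶜ, ε ≤ ∑ j, a e j := fun e he => by
    obtain ⟨s, hs, hes⟩ := hreach e
    exact le_degree_of_reflTransGen ha hes (by rintro rfl; exact (Finset.mem_compl.1 he) hs)
  have flE := fl.lump S hη1 hεh (fun t ht i hi => hlagε i (hdegE i hi) t ht)
    (flS.cont ⟨s₀, hs₀⟩) (fun t ht => flS.deriv t ht ⟨s₀, hs₀⟩)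
  -- Signal error, speed of the lumped root, and deviation of the signals of `S` from `m`.
  set b₃ := b + n * (n * b₂) + n * (2 * b₂ + b₁) with hb₃
  have hSn : ((S.card : ℕ) : ℝ) ≤ n := by exact_mod_cast (hScard.le.trans hcard.le)
  have hn2 : 0 ≤ n * (n * b₂) := by positivity
  have hn1 : 0 ≤ n * (2 * b₂ + b₁) := by positivity
  have hEm : ∀ e : ↥(Sᶜ), ExpBdd c (C_F * b₃) (fun t => |m t - z t e|) := fun e => by
    refine hF _ ?_ t₀ _ _ _ _ _ flE ?_ none ?_ c hc hcF b₃ (by positivity) ?_ ?_ none (some e)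
    · have hpos : 0 < S.card := Finset.card_pos.2 ⟨s₀, hs₀⟩
      rw [Fintype.card_option, Fintype.card_coe, Finset.card_compl, hcard]
      omega
    · intro o
      rcases o with _ | e
      · simp only [Option.elim_none, Finset.sum_const_zero]
        positivity
      · simp only [Fintype.sum_option, Option.elim_none, Option.elim_some]
        rw [Finset.sum_coe_sort (Sᶜ) (fun k => a e k), Finset.sum_add_sum_compl S]
        linarith [hdeg e]
    · have hpath : ∀ v s, Relation.ReflTransGen (fun i j => ε ≤ a i j) v s → s ∈ S →
          ∀ hv : v ∈ Sᶜ, Relation.ReflTransGen (fun o o' : Option ↥(Sᶜ) =>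
            ε ≤ o.elim (0 : ℝ) fun e => o'.elim (∑ s ∈ S, a e s) fun e' => a e e')
            (some ⟨v, hv⟩) none := by
        intro v s hvs hs
        induction hvs using Relation.ReflTransGen.head_induction_on with
        | refl => exact fun hv => absurd hs (Finset.mem_compl.1 hv)
        | @head v w hvw _ ih =>
          intro hv
          by_cases hw : w ∈ S
          · refine .single ?_
            exact hvw.trans (Finset.single_le_sum (f := fun s => a v s) (fun s _ => ha v s) hw)
          · refine (ih (Finset.mem_compl.2 hw)).head ?_
            exact hvw
      intro o
      rcases o with _ | e
      · exact .refl
      · obtain ⟨s, hs, hes⟩ := hreach e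
        exact hpath e s hes hs e.2
    · intro o
      rcases o with _ | e
      · exact ExpBdd.of_le (Eventually.of_forall fun t => by simp; positivity)
      · exact (herr e).mono_const (by linarith)
    · intro o
      rcases o with _ | e
      · have h1 : ExpBdd c (Fintype.card S * (n * b₂))
            (fun t => ∑ k : S, n * |z t k - z t s₀|) :=
          ExpBdd.sum_univ_const fun k => (hzS k ⟨s₀, hs₀⟩).const_mul (Nat.cast_nonneg n)
        refine h1.mono ?_ (Eventually.of_forall fun t => ?_)
        · rw [Fintype.card_coe]
          have := mul_le_mul_of_nonneg_right hSn (show 0 ≤ n * b₂ by positivity)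
          linarith
        · simp only [Option.elim_none, Pi.zero_apply, add_zero]
          refine (Finset.abs_sum_le_sum_abs _ _).trans (Finset.sum_le_sum fun k _ => ?_)
          rw [abs_mul, abs_of_nonneg (reducedWeight_nonneg ha hR0 _ _)]
          refine mul_le_mul_of_nonneg_right ?_ (abs_nonneg _)
          exact (Finset.single_le_sum (f := fun k => reducedWeight a R S ⟨s₀, hs₀⟩ k)
            (fun k _ => reducedWeight_nonneg ha hR0 _ k) (Finset.mem_univ k)).trans
            ((sum_reducedWeight_le ha hR0 hRa _).trans (hdeg _))
      · have h1 : ExpBdd c (Fintype.card S * (2 * b₂ + b₁))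
            (fun t => ∑ s : S, |z t s - m t|) := ExpBdd.sum_univ_const hSm
        refine h1.mono ?_ (Eventually.of_forall fun t => ?_)
        · rw [Fintype.card_coe]
          have := mul_le_mul_of_nonneg_right hSn (show 0 ≤ 2 * b₂ + b₁ by positivity)
          linarith
        · simp only [Option.elim_some]
          rw [Finset.sum_coe_sort S (fun s => |z t s - m t|)]
          refine (Finset.abs_sum_le_sum_abs _ _).trans (Finset.sum_le_sum fun s _ => ?_)
          rw [abs_mul, abs_of_nonneg (ha _ _)]
          exact mul_le_of_le_one_left (abs_nonneg _) (ha1 _ _)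
  have hb₃0 : 0 ≤ C_F * b₃ := by positivity
  have hall : ∀ i, ExpBdd c (C_F * b₃ + (2 * b₂ + b₁)) (fun t => |z t i - m t|) := fun i => by
    by_cases hi : i ∈ S
    · exact (hSm ⟨i, hi⟩).mono_const (by linarith)
    · refine (hEm ⟨i, Finset.mem_compl.2 hi⟩).mono (by linarith) (Eventually.of_forall fun t => ?_)
      rw [abs_sub_comm]
  intro i j
  refine ((hall i).add (hall j)).mono ?_ (Eventually.of_forall fun t => ?_)
  · have h1 : C_F * b₃ ≤ C_F * (B + n * (n * b₂) + n * (2 * b₂ + b₁)) :=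
      mul_le_mul_of_nonneg_left (by linarith) hC_F.le
    have h2 : C_F * (B + n * (n * b₂) + n * (2 * b₂ + b₁)) + (2 * b₂ + b₁) =
        (C_F * (1 + n * (n * (C₀ * C₁)) + n * (2 * (C₀ * C₁) + C₁)) + (2 * (C₀ * C₁) + C₁)) * B := by
      rw [hb₂, hb₁]; ring
    linarith
  · have := abs_sub_le (z t i) (m t) (z t j)
    rwa [abs_sub_comm (m t) (z t j)] at this

theorem UniformBound.mono {ι : Type} [Fintype ι] {η C C' : ℝ} {a : ι → ι → ℝ}
    (hU : UniformBound η C a) (hC : C ≤ C') : UniformBound η C' a := by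
  intro h hh
  obtain ⟨c₀, hc₀, H⟩ := hU h hh
  exact ⟨c₀, hc₀, fun c hc hcc b hb t₀ x z θ fl herr i j =>
    (H c hc hcc b hb t₀ x z θ fl herr i j).mono_const (mul_le_mul_of_nonneg_right hC hb)⟩

/-- For fixed weights and fixed maximal lag there is some bound. -/
theorem exists_bound_of_hasRoot {ι : Type} [Fintype ι] {η : ℝ} (hη : 0 < η) {a : ι → ι → ℝ}
    (ha : ∀ i j, 0 ≤ a i j) (hroot : HasRoot a) {h : ℝ} (hh : 0 ≤ h) :
    ∃ C c₀ : ℝ, 0 < C ∧ 0 < c₀ ∧ ∀ c, 0 < c → c ≤ c₀ → ∀ b, 0 ≤ b →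
      ∀ (t₀ : ℝ) (x z θ : ℝ → ι → ℝ), SampledFlow η h t₀ a x z 0 θ →
      (∀ i, ExpBdd c b (fun t => |z t i - x (θ t i) i|)) →
      ∀ i j, ExpBdd c (C * b) (fun t => |z t i - z t j|) := by
  classical
  obtain ⟨ε, hε, hεa⟩ : ∃ ε : ℝ, 0 < ε ∧ ∀ i j, 0 < a i j → ε ≤ a i j := by
    have : ∀ p : ι × ι, ∃ ε : ℝ, 0 < ε ∧ (0 < a p.1 p.2 → ε ≤ a p.1 p.2) := fun p => by
      by_cases hp : 0 < a p.1 p.2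
      · exact ⟨_, hp, fun _ => le_rfl⟩
      · exact ⟨1, one_pos, fun h => absurd h hp⟩
    choose e he hea using this
    rcases isEmpty_or_nonempty (ι × ι) with hem | hne
    · exact ⟨1, one_pos, fun i j => (hem.false (i, j)).elim⟩
    · obtain ⟨p, -, hp⟩ := Finset.exists_min_image Finset.univ e Finset.univ_nonempty
      exact ⟨e p, he p, fun i j hij => (hp (i, j) (Finset.mem_univ _)).trans (hea (i, j) hij)⟩
  have hsum : 0 ≤ ∑ i, ∑ j, a i j := Finset.sum_nonneg fun i _ => Finset.sum_nonneg fun j _ => ha i j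
  obtain ⟨C, c₀, hC, hc₀, H⟩ := SampledFlow.expBdd (Fintype.card ι) hη hε hh
    (show 0 < ∑ i, ∑ j, a i j + 1 by positivity)
  refine ⟨2 * C, c₀, by positivity, hc₀, ?_⟩
  intro c hc hcc b hb t₀ x z θ fl herr i j
  obtain ⟨r, hr⟩ := hroot
  have key := H ι le_rfl t₀ a x z 0 θ fl
    (fun i => by
      have := Finset.single_le_sum (f := fun i => ∑ j, a i j)
        (fun i _ => Finset.sum_nonneg fun j _ => ha i j) (Finset.mem_univ i)
      linarith) r
    (fun i => (hr i).lift id fun i j hij => hεa i j hij) c hc hcc b hb herr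
    (fun i => ExpBdd.of_le (Eventually.of_forall fun t => by simpa using hb))
  refine ((key r i).add (key r j)).mono (by linarith) (Eventually.of_forall fun t => ?_)
  have := abs_sub_le (z t i) (x t r) (z t j)
  rwa [abs_sub_comm (z t i) (x t r)] at this

/-- The uniform bound for weights that are separated into large and small ones. -/
theorem exists_separation {η C₀ ε : ℝ} (hη : 0 < η) (hη1 : η ≤ 1) (hC₀ : 0 < C₀) (hε : 0 < ε)
    (n : ℕ)
    (ih : ∀ (ι : Type) [Fintype ι], Fintype.card ι < n → ∀ a : ι → ι → ℝ, (∀ i j, 0 ≤ a i j) →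
      HasRoot a → UniformBound η C₀ a) :
    ∃ φ C : ℝ, 0 < φ ∧ 0 < C ∧ ∀ (ι : Type) [Fintype ι], Fintype.card ι = n →
      ∀ a : ι → ι → ℝ, (∀ i j, 0 ≤ a i j) → (∀ i j, a i j ≤ 1) → HasRoot a →
      (∃ i j, i ≠ j ∧ ε ≤ a i j) → (∀ i j, i ≠ j → ε ≤ a i j ∨ a i j ≤ φ) →
      UniformBound η C a := by
  obtain ⟨C, hC, H⟩ := exists_improvement hη hη1 hC₀ hε n ih
  have hφC : 1 / (2 * C + 1) * C ≤ 1 / 2 := by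
    rw [div_mul_eq_mul_div, div_le_iff₀ (by positivity)]
    linarith
  -- With `φ * C ≤ 1 / 2` the improvement sends `(2 * C + r) * b` to at most `(2 * C + r / 2) * b`.
  -- The graph-dependent `C_A` is halved until it drops below `C`.
  refine ⟨1 / (2 * C + 1), 3 * C, by positivity, by positivity, ?_⟩
  intro ι _ hcard a ha ha1 hroot hedge hsep h hh
  obtain ⟨c₁, hc₁, H⟩ := H (1 / (2 * C + 1)) (by positivity)
    (by rw [div_le_one (by positivity)]; linarith) ι hcard a ha ha1 hroot hedge hsep h hh
  obtain ⟨C_A, c₂, hC_A, hc₂, HA⟩ := exists_bound_of_hasRoot hη ha hroot hh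
  refine ⟨min c₁ c₂, by positivity, ?_⟩
  intro c hc hcc b hb t₀ x z θ fl herr
  have hiter : ∀ k : ℕ, ∀ i j,
      ExpBdd c ((2 * C + C_A / 2 ^ k) * b) (fun t => |z t i - z t j|) := by
    intro k
    induction k with
    | zero =>
      intro i j
      refine (HA c hc (hcc.trans (min_le_right _ _)) b hb t₀ x z θ fl herr i j).mono_const ?_
      have : 0 ≤ 2 * C * b := by positivity
      simp only [pow_zero, div_one]
      linarith
    | succ k ihk =>
      intro i j
      have hD : 0 ≤ (2 * C + C_A / 2 ^ k) * b := by positivity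
      refine (H c hc (hcc.trans (min_le_left _ _)) b hb _ hD t₀ x z θ fl herr ihk i j).mono_const ?_
      have h1 := mul_le_mul_of_nonneg_right hφC hD
      have h2 : C_A / 2 ^ (k + 1) = C_A / 2 ^ k / 2 := by rw [pow_succ]; field_simp
      rw [h2]
      linarith
  obtain ⟨k, hk⟩ := exists_nat_gt (C_A / C)
  have hk2 : C_A / 2 ^ k ≤ C := by
    rw [div_le_iff₀ (by positivity)]
    rw [div_lt_iff₀ hC] at hk
    have h1 : (k : ℝ) < 2 ^ k := by exact_mod_cast Nat.lt_two_pow_self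
    nlinarith
  intro i j
  refine (hiter k i j).mono_const (mul_le_mul_of_nonneg_right ?_ hb)
  linarith

open Classical in
/-- Induction on the number of weights below the threshold `ε`. -/
theorem exists_bound_of_card_le {η C₀ : ℝ} (hη : 0 < η) (hη1 : η ≤ 1) (hC₀ : 0 < C₀)
    (n : ℕ)
    (ih : ∀ (ι : Type) [Fintype ι], Fintype.card ι < n → ∀ a : ι → ι → ℝ, (∀ i j, 0 ≤ a i j) →
      HasRoot a → UniformBound η C₀ a) (k : ℕ) :
    ∀ ε : ℝ, 0 < ε → ∃ C : ℝ, 0 < C ∧ ∀ (ι : Type) [Fintype ι], Fintype.card ι = n →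
      ∀ a : ι → ι → ℝ, (∀ i j, 0 ≤ a i j) → (∀ i j, a i j ≤ 1) → HasRoot a →
      (∃ i j, i ≠ j ∧ ε ≤ a i j) →
      (Finset.univ.filter fun p : ι × ι => p.1 ≠ p.2 ∧ a p.1 p.2 < ε).card ≤ k →
      UniformBound η C a := by
  induction k with
  | zero =>
    intro ε hε
    obtain ⟨φ, C, -, hC, H⟩ := exists_separation hη hη1 hC₀ hε n ih
    refine ⟨C, hC, fun ι _ hcard a ha ha1 hroot hedge hk => H ι hcard a ha ha1 hroot hedge
      fun i j hij => Or.inl ?_⟩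
    by_contra! hlt
    have : (i, j) ∈ Finset.univ.filter fun p : ι × ι => p.1 ≠ p.2 ∧ a p.1 p.2 < ε := by
      simp [hij, hlt]
    rw [Finset.card_eq_zero.1 (Nat.le_zero.1 hk)] at this
    simp at this
  | succ k ihk =>
    intro ε hε
    obtain ⟨φ, C, hφ, hC, H⟩ := exists_separation hη hη1 hC₀ hε n ih
    -- If some weight lies strictly between `φ` and `ε`, the threshold `min φ ε` turns it into a
    -- large one and the count drops.
    obtain ⟨C', hC', H'⟩ := ihk (min φ ε) (by positivity)
    refine ⟨max C C', by positivity, fun ι _ hcard a ha ha1 hroot hedge hk => ?_⟩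
    by_cases hsep : ∀ i j, i ≠ j → ε ≤ a i j ∨ a i j ≤ φ
    · exact (H ι hcard a ha ha1 hroot hedge hsep).mono (le_max_left _ _)
    push Not at hsep
    obtain ⟨i, j, hij, hlt, hgt⟩ := hsep
    refine (H' ι hcard a ha ha1 hroot ?_ ?_).mono (le_max_right _ _)
    · obtain ⟨u, v, huv, h⟩ := hedge
      exact ⟨u, v, huv, (min_le_right _ _).trans h⟩
    · refine Nat.le_of_lt_succ (lt_of_lt_of_le (Finset.card_lt_card ?_) hk)
      rw [Finset.ssubset_iff_of_subset]
      · refine ⟨(i, j), by simp [hij, hlt], ?_⟩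
        simp only [Finset.mem_filter, Finset.mem_univ, true_and, not_and, not_lt]
        exact fun _ => (min_le_left _ _).trans hgt.le
      · intro p
        simp only [Finset.mem_filter, Finset.mem_univ, true_and]
        exact fun hp => ⟨hp.1, hp.2.trans_le (min_le_right _ _)⟩

/-! ### Normalization and induction on the number of agents -/

theorem ExpBdd.comp_div_iff {c b α : ℝ} (hα : 0 < α) {f : ℝ → ℝ} :
    ExpBdd (c / α) b (fun t => f (t / α)) ↔ ExpBdd c b f := by
  constructor
  · rintro ⟨K, hK, h⟩
    refine ⟨K, hK, ?_⟩
    filter_upwards [(tendsto_id.const_mul_atTop hα).eventually h] with t ht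
    simp only [id] at ht
    rwa [mul_div_cancel_left₀ _ hα.ne',
      show -(c / α) * (α * t) = -c * t by field_simp] at ht
  · rintro ⟨K, hK, h⟩
    refine ⟨K, hK, ?_⟩
    filter_upwards [(tendsto_id.atTop_div_const hα).eventually h] with t ht
    simp only [id] at ht
    rwa [show -(c / α) * t = -c * (t / α) by ring]

/-- The uniform bound does not depend on the unit of time. -/
theorem UniformBound.of_div {ι : Type} [Fintype ι] {η C α : ℝ} (hα : 0 < α) {a : ι → ι → ℝ}
    (hU : UniformBound η C fun i j => a i j / α) : UniformBound η C a := by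
  intro h hh
  obtain ⟨c₀, hc₀, H⟩ := hU (α * h) (by positivity)
  refine ⟨α * c₀, by positivity, ?_⟩
  intro c hc hcc b hb t₀ x z θ fl herr i j
  have hle : ∀ {t}, α * t₀ ≤ t → t₀ ≤ t / α := fun ht => by
    rw [le_div_iff₀ hα]; linarith
  have fl' : SampledFlow η (α * h) (α * t₀) (fun i j => a i j / α) (fun t i => x (t / α) i)
      (fun t i => z (t / α) i) 0 (fun t i => α * θ (t / α) i) :=
    { nonneg := fun i j => div_nonneg (fl.nonneg i j) hα.le
      cont := fun i => (fl.cont i).comp (by fun_prop) fun t ht => hle ht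
      deriv := fun t ht i => by
        have h1 := (fl.deriv (t / α) (hle ht) i).comp t
          (((hasDerivAt_id t).div_const α).hasDerivWithinAt (s := Ici t))
          (fun s hs => div_le_div_of_nonneg_right hs hα.le)
        refine h1.congr_deriv ?_
        simp only [Pi.zero_apply, add_zero, Finset.sum_mul]
        exact Finset.sum_congr rfl fun k _ => by ring
      le_time := fun t ht i => by
        have := mul_le_mul_of_nonneg_left (fl.le_time (t / α) (hle ht) i) hα.le
        rwa [mul_div_cancel₀ _ hα.ne'] at this
      lag := fun t ht i => by
        have := mul_le_mul_of_nonneg_left (fl.lag (t / α) (hle ht) i) hα.le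
        rwa [mul_sub, mul_div_cancel₀ _ hα.ne'] at this
      hold := fun t ht i s hs hst => by
        rw [fl.hold (t / α) (hle ht) i (s / α) (by rw [le_div_iff₀ hα]; linarith)
          (div_le_div_of_nonneg_right hst hα.le)]
      gain := fun t ht i => by
        have h1 := fl.gain (t / α) (hle ht) i
        have h2 : (∑ j, a i j / α) * (t - α * θ (t / α) i) =
            (∑ j, a i j) * (t / α - θ (t / α) i) := by
          rw [← Finset.sum_div]
          field_simp
        rw [h2]
        exact h1 }
  have key := H (c / α) (by positivity) (by rw [div_le_iff₀ hα]; linarith) b hb (α * t₀) _ _ _ fl'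
    (fun i => by
      have := (ExpBdd.comp_div_iff hα).2 (herr i)
      simpa only [mul_div_cancel_left₀ _ hα.ne'] using this) i j
  exact (ExpBdd.comp_div_iff hα).1 key

/-- Loops do not matter. -/
theorem UniformBound.of_offDiag {ι : Type} [Fintype ι] [DecidableEq ι] {η C : ℝ} {a : ι → ι → ℝ}
    (hU : UniformBound η C fun i j => if i = j then 0 else a i j) : UniformBound η C a := by
  intro h hh
  obtain ⟨c₀, hc₀, H⟩ := hU h hh
  refine ⟨c₀, hc₀, fun c hc hcc b hb t₀ x z θ fl herr => H c hc hcc b hb t₀ x z θ ?_ herr⟩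
  refine ⟨fun i j => ?_, fl.cont, fun t ht i => ?_, fl.le_time, fl.lag, fl.hold, fun t ht i => ?_⟩
  · split_ifs
    exacts [le_rfl, fl.nonneg i j]
  · refine (fl.deriv t ht i).congr_deriv ?_
    congr 1
    refine Finset.sum_congr rfl fun j _ => ?_
    by_cases hij : i = j <;> simp [hij]
  · refine (mul_le_mul_of_nonneg_right (Finset.sum_le_sum fun j _ => ?_)
      (by linarith [fl.le_time t ht i])).trans (fl.gain t ht i)
    split_ifs
    exacts [fl.nonneg i j, le_rfl]

theorem HasRoot.offDiag {ι : Type} [DecidableEq ι] {a : ι → ι → ℝ} (hroot : HasRoot a) :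
    HasRoot fun i j => if i = j then 0 else a i j := by
  obtain ⟨r, hr⟩ := hroot
  refine ⟨r, fun i => ?_⟩
  have hir := hr i
  clear hr
  induction hir with
  | refl => exact .refl
  | @tail u v _ huv ih =>
    by_cases h : u = v
    · exact h ▸ ih
    · exact ih.tail (by simpa [h] using huv)

theorem HasRoot.div {ι : Type} {a : ι → ι → ℝ} (hroot : HasRoot a) {α : ℝ} (hα : 0 < α) :
    HasRoot fun i j => a i j / α := by
  obtain ⟨r, hr⟩ := hroot
  exact ⟨r, fun i => (hr i).lift id fun u v huv => div_pos huv hα⟩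

/-- The bound on the differences of the signals depends only on `η` and the number of agents. -/
theorem exists_uniformBound {η : ℝ} (hη : 0 < η) (hη1 : η ≤ 1) (n : ℕ) :
    ∃ C : ℝ, 0 < C ∧ ∀ (ι : Type) [Fintype ι], Fintype.card ι < n → ∀ a : ι → ι → ℝ,
      (∀ i j, 0 ≤ a i j) → HasRoot a → UniformBound η C a := by
  classical
  induction n with
  | zero => exact ⟨1, one_pos, fun ι _ h => absurd h (Nat.not_lt_zero _)⟩
  | succ n ih =>
    obtain ⟨C₀, hC₀, ih⟩ := ih
    -- After division by the largest off-diagonal weight some edge has weight 1, so the threshold 1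
    -- is admissible; `n * n` counts all pairs.
    obtain ⟨C₁, hC₁, H⟩ := exists_bound_of_card_le hη hη1 hC₀ n ih (n * n) 1 one_pos
    refine ⟨max C₀ C₁, by positivity, fun ι _ hcard a ha hroot => ?_⟩
    rcases (Nat.lt_succ_iff.1 hcard).lt_or_eq with hlt | heq
    · exact (ih ι hlt a ha hroot).mono (le_max_left _ _)
    refine UniformBound.mono (UniformBound.of_offDiag ?_) (le_max_right _ _)
    have hroot' := hroot.offDiag
    set a' : ι → ι → ℝ := fun i j => if i = j then 0 else a i j with ha'
    have ha'0 : ∀ i j, 0 ≤ a' i j := fun i j => by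
      simp only [ha']
      split_ifs
      exacts [le_rfl, ha i j]
    by_cases hpos : ∃ p : ι × ι, 0 < a' p.1 p.2
    · obtain ⟨p₀, hp₀⟩ := hpos
      obtain ⟨p, -, hp⟩ := Finset.exists_max_image Finset.univ (fun p : ι × ι => a' p.1 p.2)
        ⟨p₀, Finset.mem_univ _⟩
      have hα : 0 < a' p.1 p.2 := hp₀.trans_le (hp p₀ (Finset.mem_univ _))
      refine UniformBound.of_div hα (H ι heq _ (fun i j => div_nonneg (ha'0 i j) hα.le)
        (fun i j => (div_le_one hα).2 (hp (i, j) (Finset.mem_univ _))) (hroot'.div hα)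
        ⟨p.1, p.2, fun h => ?_, (div_self hα.ne').ge⟩ ?_)
      · simp [ha', h] at hα
      · refine (Finset.card_le_univ _).trans (le_of_eq ?_)
        rw [Fintype.card_prod, heq]
    -- Without positive off-diagonal weights the root is the only agent.
    · push Not at hpos
      obtain ⟨r, hr⟩ := hroot'
      have hsub : ∀ i, i = r := fun i => by
        rcases Relation.ReflTransGen.cases_head (hr i) with h | ⟨w, hw, -⟩
        · exact h
        · exact absurd hw (hpos (i, w)).not_gt
      intro h _
      refine ⟨1, one_pos, fun c _ _ b hb t₀ x z θ _ _ i j => ExpBdd.of_le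
        (Eventually.of_forall fun t => ?_)⟩
      rw [hsub i, hsub j, sub_self, abs_zero]
      positivity

/-! ### Self-triggered trajectories -/

theorem lastIndex_eq {s : ℕ → ℝ} (hs : StrictMono s) {t : ℝ} {k : ℕ} (hk : s k ≤ t)
    (hk' : t < s (k + 1)) : lastIndex s t = k := by
  have : {m : ℕ | s m ≤ t} = Iic k := by
    ext m
    constructor
    · intro hm
      exact Nat.lt_succ_iff.1 (hs.lt_iff_lt.1 (lt_of_le_of_lt hm hk'))
    · intro hm
      exact (hs.monotone hm).trans hk
  rw [lastIndex, this, csSup_Iic]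

theorem lastIndex_spec {s : ℕ → ℝ} (hs : StrictMono s) (hs' : Tendsto s atTop atTop) {t : ℝ}
    (ht : s 0 ≤ t) : s (lastIndex s t) ≤ t ∧ t < s (lastIndex s t + 1) := by
  classical
  have hex : ∃ m, t < s m := (hs'.eventually_gt_atTop t).exists
  obtain ⟨k, hk⟩ : ∃ k, Nat.find hex = k + 1 := Nat.exists_eq_succ_of_ne_zero fun h => by
    have := Nat.find_spec hex
    rw [h] at this
    linarith
  have h1 : t < s (k + 1) := hk ▸ Nat.find_spec hex
  have h2 : s k ≤ t := not_lt.1 (Nat.find_min hex (by omega))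
  rw [lastIndex_eq hs h2 h1]
  exact ⟨h2, h1⟩

/-- Capping the coordinates at their minimum plus `d` gives a point of the set and moves each
coordinate by at most `e`. -/
theorem infDist_spread_le {n : ℕ} {x : Fin n → ℝ} {d e : ℝ} (hd : 0 ≤ d) (he : 0 ≤ e) (i₀ : Fin n)
    (hx : ∀ i j, |x i - x j| ≤ d + e) :
    Metric.infDist x {z : Fin n → ℝ | spread z ≤ d} ≤ e := by
  have : Nonempty (Fin n) := ⟨i₀⟩
  obtain ⟨m, -, hm⟩ := Finset.exists_min_image Finset.univ x Finset.univ_nonempty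
  have hmem : (fun i => min (x i) (x m + d)) ∈ {z : Fin n → ℝ | spread z ≤ d} := by
    have h1 : (⨆ i, min (x i) (x m + d)) ≤ x m + d := ciSup_le fun i => min_le_right _ _
    have h2 : x m ≤ ⨅ i, min (x i) (x m + d) :=
      le_ciInf fun i => le_min (hm i (Finset.mem_univ i)) (by linarith)
    change (⨆ i, min (x i) (x m + d)) - (⨅ i, min (x i) (x m + d)) ≤ d
    linarith
  refine (Metric.infDist_le_dist_of_mem hmem).trans ((dist_pi_le_iff he).2 fun i => ?_)
  rw [Real.dist_eq]
  have h1 := (abs_le.1 (hx i m)).2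
  rcases min_cases (x i) (x m + d) with ⟨h, _⟩ | ⟨h, h'⟩
  · rw [h, sub_self, abs_zero]
    exact he
  · rw [h, abs_of_nonneg (by linarith)]
    linarith

theorem laplacian_self {n : ℕ} {A : Matrix (Fin n) (Fin n) ℝ} (hA : IsAdjacency A) (i : Fin n) :
    laplacian A i i = ∑ j, A i j := by
  simp [laplacian, inDegree, hA.2 i]

theorem input_eq {n : ℕ} {A : Matrix (Fin n) (Fin n) ℝ} (hA : IsAdjacency A) (q : ℝ → ℝ)
    (s : Fin n → ℕ → ℝ) (x : ℝ → Fin n → ℝ) (t : ℝ) (i : Fin n) :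
    input A q s x t i = ∑ j, A i j * (q (sampled s x t j) - q (sampled s x t i)) := by
  rw [input, Finset.sum_filter]
  refine Finset.sum_congr rfl fun j _ => ?_
  split_ifs with h
  · have hij : i ≠ j := by
      rintro rfl
      rw [hA.2 i] at h
      exact lt_irrefl _ h
    rw [laplacian, Matrix.sub_apply, Matrix.diagonal_apply_ne _ hij]
    ring
  · rw [le_antisymm (not_lt.1 h) (hA.1 i j), zero_mul]

/-- Spanning-tree paths follow the information flow away from the root; those of `HasRoot` run
against it. -/
theorem HasDeltaSpanningTree.hasRoot {n : ℕ} {δ : ℝ} (hδ : 0 < δ) {A : Matrix (Fin n) (Fin n) ℝ}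
    (h : HasDeltaSpanningTree δ A) : HasRoot fun i j => A i j := by
  obtain ⟨r, hr⟩ := h
  refine ⟨r, fun i => ?_⟩
  by_cases hir : i = r
  · exact hir ▸ .refl
  have h1 := (hr i hir).to_reflTransGen
  have h2 := Relation.reflTransGen_swap.2 h1
  refine h2.lift id fun u v huv => ?_
  change 0 < if δ ≤ A u v then δ else 0 at huv
  change 0 < A u v
  split_ifs at huv with h
  · exact hδ.trans_le h
  · exact absurd huv (lt_irrefl _)

section Trajectory

variable {n : ℕ} {A : Matrix (Fin n) (Fin n) ℝ} {q : ℝ → ℝ} {s : Fin n → ℕ → ℝ} {t₀ : ℝ}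
  {x : ℝ → Fin n → ℝ} {δs : Fin n → ℝ}

/-- The sampling times, with the current time for agents without neighbours. -/
def samplingTime (A : Matrix (Fin n) (Fin n) ℝ) (s : Fin n → ℕ → ℝ) (t : ℝ) (i : Fin n) : ℝ :=
  if ∑ j, A i j = 0 then t else s i (lastIndex (s i) t)

/-- The rule bounds degree times age by `1 - δ_i ≤ 1 - η`. Agents of degree zero have no bound on
their sample age, so the current time replaces their sampling time; they contribute `1 / 0 = 0` to
the lag bound. -/
theorem IsTrajectory.sampledFlow (hA : IsAdjacency A) (hx : IsTrajectory A q s t₀ x)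
    (hs : ∀ i, IsTriggerSequence (laplacian A i i) (δs i) (s i)) {η : ℝ} (hη1 : η ≤ 1)
    (hηδ : ∀ i, 0 < δs i ∧ η ≤ δs i) :
    SampledFlow η (∑ i, 1 / ∑ j, A i j) t₀ (fun i j => A i j) x
      (fun t i => q (sampled s x t i)) 0 (samplingTime A s) := by
  have hdeg : ∀ i, 0 ≤ ∑ j, A i j := fun i => Finset.sum_nonneg fun j _ => hA.1 i j
  have hinv : ∀ i, 0 ≤ 1 / ∑ j, A i j := fun i => by have := hdeg i; positivity
  have hspec : ∀ t, t₀ ≤ t → ∀ i, s i (lastIndex (s i) t) ≤ t ∧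
      t < s i (lastIndex (s i) t + 1) := fun t ht i =>
    lastIndex_spec (hs i).strictMono (hs i).unbounded
      ((hx.started i).trans ht)
  have hage : ∀ t, t₀ ≤ t → ∀ i, ∑ j, A i j ≠ 0 →
      (∑ j, A i j) * (t - s i (lastIndex (s i) t)) ≤ 1 - δs i := by
    intro t ht i hi
    have hpos : 0 < ∑ j, A i j := lt_of_le_of_ne (hdeg i) hi.symm
    have h1 := ((hs i).rule (by rwa [laplacian_self hA]) (lastIndex (s i) t)).2
    rw [laplacian_self hA] at h1
    have h2 : t - s i (lastIndex (s i) t) ≤ (1 - δs i) / ∑ j, A i j := by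
      linarith [(hspec t ht i).2]
    rw [le_div_iff₀ hpos] at h2
    linarith
  refine ⟨fun i j => hA.1 i j, fun i => ?_, fun t ht i => ?_, fun t ht i => ?_, fun t ht i => ?_,
    fun t ht i u hu hut => ?_, fun t ht i => ?_⟩
  · exact (continuous_apply i).comp_continuousOn hx.continuousOn
  · have := hx.deriv t ht i
    rw [input_eq hA] at this
    simpa using this
  · simp only [samplingTime]
    split_ifs
    exacts [le_rfl, (hspec t ht i).1]
  · have hle : 1 / ∑ j, A i j ≤ ∑ i, 1 / ∑ j, A i j :=
      Finset.single_le_sum (f := fun i => 1 / ∑ j, A i j) (fun i _ => hinv i) (Finset.mem_univ i)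
    simp only [samplingTime]
    split_ifs with hi
    · linarith [hinv i]
    · have hpos : 0 < ∑ j, A i j := lt_of_le_of_ne (hdeg i) (Ne.symm hi)
      have h1 := lag_of_le_degree hpos (hηδ i).1.le (by linarith [(hspec t ht i).1]) le_rfl
        (hage t ht i hi)
      linarith
  · simp only [samplingTime] at hu ⊢
    split_ifs at hu ⊢
    · linarith
    · rw [lastIndex_eq (hs i).strictMono hu (hut.trans_lt (hspec t ht i).2)]
  · simp only [samplingTime]
    split_ifs with hi
    · rw [sub_self, mul_zero]
      linarith
    · linarith [hage t ht i hi, (hηδ i).2]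

/-- An agent of degree zero stands still, so once it has triggered after `t₀` its sample equals its
current state. Earlier samples are arbitrary data, hence only an eventual bound. -/
theorem IsTrajectory.eventually_abs_sub_le (hA : IsAdjacency A) (hx : IsTrajectory A q s t₀ x)
    (hs : ∀ i, IsTriggerSequence (laplacian A i i) (δs i) (s i)) {δu : ℝ}
    (hq : IsUniformQuantizer q δu) (i : Fin n) :
    ∀ᶠ t in atTop, |q (sampled s x t i) - x (samplingTime A s t i) i| ≤ δu := by
  by_cases hi : ∑ j, A i j = 0
  swap
  · refine Eventually.of_forall fun t => ?_
    simp only [samplingTime, hi, if_false]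
    exact hq _
  have hzero : ∀ j, A i j = 0 := fun j =>
    (Finset.sum_eq_zero_iff_of_nonneg fun j _ => hA.1 i j).1 hi j (Finset.mem_univ j)
  obtain ⟨k, hk⟩ := ((hs i).unbounded.eventually_ge_atTop t₀).exists
  filter_upwards [eventually_ge_atTop (s i k)] with t ht
  have hspec := lastIndex_spec (hs i).strictMono (hs i).unbounded
    (((hs i).strictMono.monotone (Nat.zero_le k)).trans ht)
  have hk' : s i k ≤ s i (lastIndex (s i) t) := (hs i).strictMono.monotone
    (Nat.lt_succ_iff.1 ((hs i).strictMono.lt_iff_lt.1 (ht.trans_lt hspec.2)))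
  have hcont : ContinuousOn (fun u => x u i) (Icc (s i (lastIndex (s i) t)) t) :=
    ((continuous_apply i).comp_continuousOn hx.continuousOn).mono
      fun u hu => mem_Ici.2 (by linarith [hu.1])
  have hder : ∀ u ∈ Ico (s i (lastIndex (s i) t)) t,
      HasDerivWithinAt (fun u => x u i) (input A q s x u i) (Ici u) u := fun u hu =>
    hx.deriv u (by linarith [hu.1]) i
  have hin : ∀ u, input A q s x u i = 0 := fun u => by
    rw [input_eq hA]
    simp [hzero]
  have h1 := le_add_mul_of_rightDeriv_le (k := 0) hcont hder (fun u _ => (hin u).le)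
    ⟨hspec.1, le_rfl⟩
  have h2 := add_mul_le_of_le_rightDeriv (k := 0) hcont hder (fun u _ => (hin u).ge)
    ⟨hspec.1, le_rfl⟩
  have heq : x t i = sampled s x t i := by
    rw [sampled]
    linarith
  simp only [samplingTime, hi, if_true]
  rw [heq]
  exact hq _

end Trajectory

theorem convergesExponentiallyTo_of_expBdd {n : ℕ} {x : ℝ → Fin n → ℝ} {t₀ c d : ℝ} (hc : 0 ≤ c)
    (hd : 0 ≤ d) (i₀ : Fin n) (hx : ContinuousOn x (Ici t₀))
    (h : ∀ i j, ExpBdd c d (fun t => |x t i - x t j|)) :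
    ConvergesExponentiallyTo x t₀ {z : Fin n → ℝ | spread z ≤ d} c := by
  obtain ⟨K, hK, hev⟩ := ExpBdd.exists_forall_window (ι := Fin n × Fin n)
    (F := fun p t => |x t p.1 - x t p.2|) hc (fun p => h p.1 p.2) 0
  obtain ⟨T, hT⟩ := eventually_atTop.1 hev
  obtain ⟨B, hB⟩ := isCompact_Icc.exists_bound_of_continuousOn
    (hx.mono fun t (ht : t ∈ Icc t₀ T) => ht.1)
  have hsplit : ∀ t, Real.exp (-c * t) = Real.exp (-c * t₀) * Real.exp (-c * (t - t₀)) := fun t => by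
    rw [← Real.exp_add]
    ring_nf
  -- The second term covers the compact interval from `t₀` to `T`, where the distance to the
  -- consensus point 0 is at most `|B|`.
  refine ⟨K * Real.exp (-c * t₀) + |B| * Real.exp (c * (T - t₀)), by positivity, fun t ht => ?_⟩
  have hE := (Real.exp_pos (-c * (t - t₀))).le
  rcases le_total T t with hTt | hTt
  · have h1 := infDist_spread_le hd (show 0 ≤ K * Real.exp (-c * t) by positivity) i₀
      fun i j => hT t hTt t (by linarith) (i, j)
    rw [hsplit t, ← mul_assoc] at h1
    refine h1.trans (mul_le_mul_of_nonneg_right ?_ hE)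
    exact le_add_of_nonneg_right (by positivity)
  · have hmem : (0 : Fin n → ℝ) ∈ {z : Fin n → ℝ | spread z ≤ d} := by
      change (⨆ _ : Fin n, (0 : ℝ)) - (⨅ _ : Fin n, (0 : ℝ)) ≤ d
      have : Nonempty (Fin n) := ⟨i₀⟩
      simpa using hd
    have h1 := Metric.infDist_le_dist_of_mem (x := x t) hmem
    rw [dist_zero_right] at h1
    have h2 : 1 ≤ Real.exp (c * (T - t₀)) * Real.exp (-c * (t - t₀)) := by
      rw [← Real.exp_add]
      exact Real.one_le_exp (by nlinarith)
    calc Metric.infDist (x t) _ ≤ |B| := h1.trans ((hB t ⟨ht, hTt⟩).trans (le_abs_self B))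
      _ ≤ |B| * (Real.exp (c * (T - t₀)) * Real.exp (-c * (t - t₀))) :=
        le_mul_of_one_le_right (abs_nonneg B) h2
      _ ≤ _ := by
        rw [add_mul, mul_assoc |B|]
        exact le_add_of_nonneg_left (by positivity)

end SelfTriggered

end

theorem theorem2 (n : ℕ) (δ : ℝ) (hδ : 0 < δ) (δs : Fin n → ℝ)
    (hδs : ∀ i, δs i ∈ Set.Ioo (0 : ℝ) (1 / 2)) :
    ∃ C₂ : ℝ, 0 < C₂ ∧
      ∀ A : Matrix (Fin n) (Fin n) ℝ, SelfTriggered.IsAdjacency A →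
        SelfTriggered.HasDeltaSpanningTree δ A →
        ∃ c : ℝ, 0 < c ∧
          ∀ (q : ℝ → ℝ) (δu : ℝ), SelfTriggered.IsUniformQuantizer q δu →
          ∀ s : Fin n → ℕ → ℝ,
            (∀ i, SelfTriggered.IsTriggerSequence (SelfTriggered.laplacian A i i) (δs i) (s i)) →
          ∀ (t₀ : ℝ) (x : ℝ → Fin n → ℝ), SelfTriggered.IsTrajectory A q s t₀ x →
            SelfTriggered.ConvergesExponentiallyTo x t₀
              {z : Fin n → ℝ | SelfTriggered.spread z ≤ C₂ * δu} c := by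
  open SelfTriggered in
  obtain ⟨η, hη, hη1, hηδ⟩ : ∃ η : ℝ, 0 < η ∧ η ≤ 1 ∧ ∀ i, η ≤ δs i := by
    rcases isEmpty_or_nonempty (Fin n) with hem | hne
    · exact ⟨1, one_pos, le_rfl, fun i => hem.elim i⟩
    · obtain ⟨m, -, hm⟩ := Finset.exists_min_image Finset.univ δs Finset.univ_nonempty
      exact ⟨δs m, (hδs m).1, by linarith [(hδs m).2], fun i => hm i (Finset.mem_univ i)⟩
  obtain ⟨C, hC, H⟩ := exists_uniformBound hη hη1 (n + 1)
  -- Two state-to-signal distances `(1 + C) * δu` and one signal difference `C * δu`.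
  refine ⟨3 * C + 2, by positivity, fun A hA htree => ?_⟩
  have hinv : 0 ≤ ∑ i, 1 / ∑ j, A i j := Finset.sum_nonneg fun i _ =>
    one_div_nonneg.2 (Finset.sum_nonneg fun j _ => hA.1 i j)
  obtain ⟨c, hc, hU⟩ := H (Fin n) (by simp) (fun i j => A i j) hA.1 (htree.hasRoot hδ) _ hinv
  refine ⟨c, hc, fun q δu hq s hs t₀ x hx => ?_⟩
  have hδu : 0 ≤ δu := (abs_nonneg _).trans (hq 0)
  have fl := hx.sampledFlow hA hs hη1 fun i => ⟨(hδs i).1, hηδ i⟩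
  have herr : ∀ i, ExpBdd c δu (fun t => |q (sampled s x t i) - x (samplingTime A s t i) i|) :=
    fun i => ExpBdd.of_le (hx.eventually_abs_sub_le hA hs hq i)
  have hz := hU c hc le_rfl δu hδu t₀ x _ _ fl herr
  have hxz := fl.expBdd_sub hη.le hinv hc.le (by positivity) herr hz
  obtain ⟨r, -⟩ := htree
  refine convergesExponentiallyTo_of_expBdd hc.le (by positivity) r hx.continuousOn fun i j => ?_
  refine (((hxz i).add (hz i j)).add (hxz j)).mono (by linarith)
    (Filter.Eventually.of_forall fun t => ?_)
  have h1 := abs_sub_le (x t i) (q (sampled s x t i)) (x t j)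
  have h2 := abs_sub_le (q (sampled s x t i)) (q (sampled s x t j)) (x t j)
  rw [abs_sub_comm (q (sampled s x t j)) (x t j)] at h2
  linarith
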